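/- Let $G=F_2$ be the free group on two generators (with the discrete topology), and let $\Omega$ be its boundary: the compact space of one-sided infinite reduced words in $a,b,a^{-1},b^{-1}$, on which $G$ acts by concatenation followed by cancellation. Let $\Omega=P_0\sqcup P_1$ be a partition into two nonempty clopen sets, let $\phi:\Omega\to\{0,1\}^G$ be the name map, $\phi(\omega)(g)=\epsilon$ when $g\omega\in P_\epsilon$, and let $X=\phi(\Omega)$, with the action $(hx)(g)=x(gh)$. Then $(X,G)$ is minimal (every orbit is dense) and strongly proximal (for any two Borel probability measures $\mu,\nu$ on $X$ there is a net $(g_i)$ in $G$ such that $g_i\mu$ and $g_i\nu$ converge weak$^*$ to the same measure). Moreover, for every $0<\delta<1$ there are a separable real Banach space $V$ that is Rosenthal (it contains no isomorphic copy of $\ell_1(\mathbb N)$) and a representation of $(X,G)$ on $V$, that is, a co-homomorphism $h:G\to\mathrm{Iso}(V)$ into the group of linear isometries of $V$ onto itself ($h(gg')=h(g')h(g)$) and a bounded weak$^*$ continuous map $\alpha:X\to V^*$ with $\alpha(gx)=g\,\alpha(x)$ for the dual action $(g\varphi)(v)=\varphi(h(g)v)$ on $V^*$, such that: 1. the only $G$-fixed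 point in $V^*$ is $0$; 2. there is $\xi\in V^*$ with $\|\xi\|=1$ and $\|g\xi-\xi\|\le\delta$ for every $g\in G$. Here $V$ can be taken to be a Davis–Figiel–Johnson–Pełczyński space of the following form. For some $f\in C(X)$ (real-valued functions, sup norm, closed unit ball $B$), let $F$ be the norm closure of $\{f\circ g: g\in G\}$, let $W=\mathrm{conv}(F\cup -F)$, let $\|\cdot\|_n$ be the Minkowski functional of $2^nW+2^{-n}B$, and let $N(v)=\big(\sum_{n\ge1}\|v\|_n^2\big)^{1/2}$; then $V=\{v\in C(X):N(v)<\infty\}$ with norm $N$, $h(g)v=v\circ g$ and $\alpha(x)(v)=v(x)$. Consequently the following assertion is false for every $0<\delta<1$: "whenever a discrete group $\Gamma$ acts by linear isometries on a Banach space $E$ and $\varphi\in E^*$ satisfies $\|\varphi\|=1$ and $\|g\varphi-\varphi\|\le\delta/10$ for all $g\in\Gamma$, there is a $\Gamma$-invariant $\beta\in E^*$ with $\|\varphi-\beta\|\le\delta$." -/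

import Mathlib

open scoped Pointwise

noncomputable section

/-! ### The free group on two generators and its boundary -/

/-- The free group on two generators (regarded as a discrete group). -/
abbrev F2 : Type := FreeGroup (Fin 2)

/-- The four letters `a, b, a⁻¹, b⁻¹`: `(i, true)` is the `i`-th generator, `(i, false)` its inverse
(the convention of `FreeGroup`). -/
abbrev Letter : Type := Fin 2 × Bool

/-- The formal inverse of a letter. -/
def Letter.bar (s : Letter) : Letter := (s.1, !s.2)

theorem Letter.bar_bar (s : Letter) : s.bar.bar = s := by
  simp [Letter.bar]

/-- The boundary of `F2`: one-sided infinite reduced words, with the topology induced by the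
product of the discrete topologies. -/
def Boundary : Type := {ω : ℕ → Letter // ∀ n, ω (n + 1) ≠ (ω n).bar}

instance : TopologicalSpace Boundary :=
  inferInstanceAs (TopologicalSpace {ω : ℕ → Letter // ∀ n, ω (n + 1) ≠ (ω n).bar})

instance : CompactSpace Boundary := by
  have h : IsClosed {ω : ℕ → Letter | ∀ n, ω (n + 1) ≠ (ω n).bar} := by
    simp only [Set.ofPred_forall]
    refine isClosed_iInter fun n => ?_
    have hc : Continuous fun ω : ℕ → Letter => (ω (n + 1), ω n) := by fun_prop
    exact (isClosed_discrete {p : Letter × Letter | p.1 ≠ p.2.bar}).preimage hc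
  exact isCompact_iff_compactSpace.mp h.isCompact

namespace Boundary

/-- The word `s ω` for a letter `s` that does not cancel against the first letter of `ω`. -/
def cons (s : Letter) (ω : Boundary) (h : ω.1 0 ≠ s.bar) : Boundary :=
  ⟨fun n => Nat.casesOn n s ω.1, fun n => by
    cases n with
    | zero => exact h
    | succ n => exact ω.2 n⟩

/-- The word `ω` with its first letter deleted. -/
def tail (ω : Boundary) : Boundary := ⟨fun n => ω.1 (n + 1), fun n => ω.2 (n + 1)⟩

/-- Concatenation of the letter `s` and the word `ω`, followed by the cancellation
of `s` against the first letter of `ω` if they are mutually inverse. -/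
def letterMul (s : Letter) (ω : Boundary) : Boundary :=
  if h : ω.1 0 = s.bar then ω.tail else ω.cons s h

theorem letterMul_bar (s : Letter) (ω : Boundary) : letterMul s.bar (letterMul s ω) = ω := by
  by_cases h : ω.1 0 = s.bar
  · have h1 : letterMul s ω = ω.tail := dif_pos h
    have h2 : ω.tail.1 0 ≠ s.bar.bar := by
      rw [← h]; exact ω.2 0
    rw [h1, letterMul, dif_neg h2]
    apply Subtype.ext
    funext n
    cases n with
    | zero => exact h.symm
    | succ n => rfl
  · have h1 : letterMul s ω = ω.cons s h := dif_neg h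
    have h2 : (ω.cons s h).1 0 = s.bar.bar := by
      rw [Letter.bar_bar]; rfl
    rw [h1, letterMul, dif_pos h2]
    rfl

theorem continuous_letterMul (s : Letter) : Continuous (letterMul s) := by
  refine continuous_induced_rng.mpr (continuous_pi fun n => ?_)
  have hval (k : ℕ) : Continuous fun ω : Boundary => ω.1 k :=
    (continuous_apply k).comp continuous_subtype_val
  let F : Letter × Letter × Letter → Letter := fun p =>
    if p.1 = s.bar then p.2.1 else if n = 0 then s else p.2.2
  have key : (fun ω : Boundary => (letterMul s ω).1 n) =
      fun ω => F (ω.1 0, ω.1 (n + 1), ω.1 (n - 1)) := by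
    funext ω
    by_cases h : ω.1 0 = s.bar
    · simp [F, letterMul, h, tail]
    · cases n <;> simp [F, letterMul, h, cons]
  change Continuous fun ω : Boundary => (letterMul s ω).1 n
  rw [key]
  have hF : Continuous F := continuous_of_discreteTopology
  exact hF.comp ((hval 0).prodMk ((hval (n + 1)).prodMk (hval (n - 1))))

/-- A generator acts by `letterMul`, its inverse by `letterMul` of the inverse letter. -/
def genPerm (i : Fin 2) : Equiv.Perm Boundary where
  toFun := letterMul (i, true)
  invFun := letterMul (i, false)
  left_inv := letterMul_bar (i, true)
  right_inv := letterMul_bar (i, false)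

/-- The action of `F2` on its boundary: concatenation followed by the needed cancellations. -/
instance : MulAction F2 Boundary := MulAction.compHom Boundary (FreeGroup.lift genPerm)

theorem smul_def (g : F2) (ω : Boundary) : g • ω = FreeGroup.lift genPerm g ω := rfl

instance : ContinuousConstSMul F2 Boundary where
  continuous_const_smul g := by
    induction g using FreeGroup.induction_on with
    | C1 => simp only [one_smul]; exact continuous_id
    | of i => exact continuous_letterMul (i, true)
    | inv_of i _ =>
      have : (fun ω : Boundary => (FreeGroup.of i)⁻¹ • ω) = letterMul (i, false) := by
        funext ω
        rw [smul_def, map_inv, FreeGroup.lift_apply_of]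
        rfl
      change Continuous fun ω : Boundary => (FreeGroup.of i)⁻¹ • ω
      rw [this]
      exact continuous_letterMul _
    | mul g h hg hh =>
      simp only [mul_smul]
      exact hg.comp hh

end Boundary

/-! ### The boundary subshift of a clopen partition -/

/-- The name map `φ(ω)(g) = 1` iff `g • ω ∈ P`, for the clopen partition `Pᶜ ⊔ P` of the
boundary (`P` plays the part of `P₁`). -/
def nameMap (P : TopologicalSpace.Clopens Boundary) (ω : Boundary) : F2 → Bool :=
  open Classical in fun g => decide (g • ω ∈ P)

theorem continuous_nameMap (P : TopologicalSpace.Clopens Boundary) : Continuous (nameMap P) := by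
  refine continuous_pi fun g => ?_
  have h : IsClopen {ω : Boundary | g • ω ∈ P} := P.isClopen.preimage (continuous_const_smul g)
  refine (continuous_bool_rng true).mpr ?_
  have : (fun ω => nameMap P ω g) ⁻¹' {true} = {ω : Boundary | g • ω ∈ P} := by
    ext ω; simp [nameMap]
  rw [this]
  exact h

/-- The subshift `φ(Ω) ⊆ {0,1}^G`. -/
def BoundarySubshift (P : TopologicalSpace.Clopens Boundary) : Type :=
  {x : F2 → Bool // x ∈ Set.range (nameMap P)}

namespace BoundarySubshift

variable (P : TopologicalSpace.Clopens Boundary)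

instance : TopologicalSpace (BoundarySubshift P) :=
  inferInstanceAs (TopologicalSpace {x : F2 → Bool // x ∈ Set.range (nameMap P)})

instance : CompactSpace (BoundarySubshift P) :=
  isCompact_iff_compactSpace.mp (isCompact_range (continuous_nameMap P))

instance : MeasurableSpace (BoundarySubshift P) := borel _

instance : BorelSpace (BoundarySubshift P) := ⟨rfl⟩

/-- The shift action `(h • x)(g) = x(gh)`, the one for which the name map is equivariant. -/
instance : MulAction F2 (BoundarySubshift P) where
  smul h x := ⟨fun g => x.1 (g * h), by
    obtain ⟨ω, hω⟩ := x.2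
    refine ⟨h • ω, ?_⟩
    rw [← hω]
    funext g
    simp [nameMap, mul_smul]⟩
  one_smul x := Subtype.ext (funext fun g => congrArg x.1 (mul_one g))
  mul_smul h k x := Subtype.ext (funext fun g => congrArg x.1 (mul_assoc g h k).symm)

instance : ContinuousConstSMul F2 (BoundarySubshift P) where
  continuous_const_smul h := by
    refine continuous_induced_rng.mpr (continuous_pi fun g => ?_)
    exact (continuous_apply (g * h)).comp continuous_subtype_val

end BoundarySubshift

/-! ### Strong proximality -/

/-- A family of self-maps `(act g)` of `Y` is proximal if any two points are sent to a common limit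
along some net of indices `g` (expressed by a proper filter). -/
def IsProximalFamily {G Y : Type*} [TopologicalSpace Y] (act : G → Y → Y) : Prop :=
  ∀ x y : Y, ∃ z : Y, ∃ l : Filter G, l.NeBot ∧
    Filter.Tendsto (fun g => act g x) l (nhds z) ∧ Filter.Tendsto (fun g => act g y) l (nhds z)

/-- Strong proximality: the induced action on the Borel probability measures, with the
weak-* topology, is proximal. -/
def IsStronglyProximal (G X : Type*) [Group G] [TopologicalSpace X] [MeasurableSpace X]
    [BorelSpace X] [MulAction G X] [ContinuousConstSMul G X] : Prop :=
  IsProximalFamily fun (g : G) (μ : MeasureTheory.ProbabilityMeasure X) =>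
    μ.map (f := fun x : X => g • x) (continuous_const_smul g).measurable.aemeasurable

/-! ### Banach spaces and representations -/

/-- A Banach space is Rosenthal if it contains no isomorphic copy of `ℓ₁(ℕ)`. -/
def IsRosenthal (V : Type*) [NormedAddCommGroup V] [NormedSpace ℝ V] : Prop :=
  ¬ ∃ T : lp (fun _ : ℕ => ℝ) 1 →L[ℝ] V, ∃ c : ℝ, 0 < c ∧ ∀ x, c * ‖x‖ ≤ ‖T x‖

/-- A representation `(h, α)` of a dynamical system `(X, G)` of a discrete group `G` on a Banach
space `V`: a co-homomorphism `h` into the group of linear isometries of `V` onto itself, and a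
bounded weak-* continuous map `α : X → V*` that is equivariant for the dual action
`(g φ)(v) = φ (h g v)`. -/
structure BanachRepresentation (G X V : Type*) [Group G] [TopologicalSpace X] [MulAction G X]
    [NormedAddCommGroup V] [NormedSpace ℝ V] where
  h : G → (V ≃ₗᵢ[ℝ] V)
  h_mul : ∀ g g' : G, h (g * g') = h g' * h g
  α : X → StrongDual ℝ V
  continuous_α : Continuous fun x => StrongDual.toWeakDual (α x)
  bounded_α : ∃ C : ℝ, ∀ x, ‖α x‖ ≤ C
  equivariant_α : ∀ (g : G) (x : X) (v : V), α (g • x) v = α x (h g v)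

/-- The dual action `(g φ)(v) = φ (h g v)` of a representation. -/
def BanachRepresentation.dualAct {G X V : Type*} [Group G] [TopologicalSpace X] [MulAction G X]
    [NormedAddCommGroup V] [NormedSpace ℝ V] (R : BanachRepresentation G X V) (g : G)
    (φ : StrongDual ℝ V) : StrongDual ℝ V :=
  φ.comp ((R.h g).toContinuousLinearEquiv : V →L[ℝ] V)

/-! ### The Davis–Figiel–Johnson–Pełczyński construction -/

/-- `W = conv (F ∪ -F)`, where `F` is the norm closure in `C(X)` of the orbit
`{f ∘ g : g ∈ G}`. -/
def orbitHull (G : Type*) {X : Type*} [Group G] [TopologicalSpace X] [CompactSpace X]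
    [MulAction G X] [ContinuousConstSMul G X] (f : C(X, ℝ)) : Set C(X, ℝ) :=
  let F : Set C(X, ℝ) :=
    closure (Set.range fun g : G => f.comp ⟨fun x => g • x, continuous_const_smul g⟩)
  convexHull ℝ (F ∪ -F)

/-- `M_n = 2^n W + 2^{-n} B`, with `B` the closed unit ball. -/
def dfjpSet {A : Type*} [NormedAddCommGroup A] [NormedSpace ℝ A] (W : Set A) (n : ℕ) : Set A :=
  ((2 : ℝ) ^ n) • W + ((2 : ℝ) ^ n)⁻¹ • Metric.closedBall (0 : A) 1

/-- `j : V → A` is (up to isometric isomorphism) the inclusion of the DFJP space of `W ⊆ A`: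
with `‖·‖ₙ` the Minkowski functional of `M_n` and `N(v) = (∑_{n ≥ 1} ‖v‖ₙ²)^{1/2}`, the image of `j`
is `{v : N(v) < ∞}` and the norm of `V` is `N`. -/
structure IsDFJPInclusion {A V : Type*} [NormedAddCommGroup A] [NormedSpace ℝ A]
    [NormedAddCommGroup V] [NormedSpace ℝ V] (W : Set A) (j : V →L[ℝ] A) : Prop where
  mem_range_iff : ∀ a : A, a ∈ Set.range j ↔
    Summable fun n : ℕ => gauge (dfjpSet W (n + 1)) a ^ 2
  norm_eq : ∀ v : V, ‖v‖ = √(∑' n : ℕ, gauge (dfjpSet W (n + 1)) (j v) ^ 2)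

/-! ### The question on almost invariant functionals -/

/-- The assertion of the question of Kazhdan and Yom Din for a given `δ`: for every linear isometric
action of a discrete group `G` on a Banach space `V`, every `φ ∈ V*` with `‖φ‖ = 1` and
`‖g φ - φ‖ ≤ δ / 10` for all `g` is at distance at most `δ` from a `G`-invariant functional.
Here `(g φ)(v) = φ (g⁻¹ v)`. -/
def AlmostInvariantAssertion (δ : ℝ) : Prop :=
  ∀ (G : Type) [Group G] (V : Type) [NormedAddCommGroup V] [NormedSpace ℝ V] [CompleteSpace V]
    (ρ : G →* (V ≃ₗᵢ[ℝ] V)) (φ : StrongDual ℝ V), ‖φ‖ = 1 →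
    (∀ g : G, ‖φ.comp ((ρ g⁻¹).toContinuousLinearEquiv : V →L[ℝ] V) - φ‖ ≤ δ / 10) →
    ∃ β : StrongDual ℝ V,
      (∀ g : G, β.comp ((ρ g⁻¹).toContinuousLinearEquiv : V →L[ℝ] V) = β) ∧ ‖φ - β‖ ≤ δ

end

/-! Take `f = 1 + ε` on the part of the subshift coming from `P` and `f = 1` off it, with `ε` small,
and let `V` be the DFJP space of the orbit of `f`.

Almost invariance. Every element of the hull `W` oscillates by at most `ε`, and a unit vector of `V`
lies within `2·2⁻ⁿ` of `2·2ⁿ W` for each `n ≥ 1`. Choosing `n` first and then `ε`, all evaluations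
are close to one another in `V*`. They are not small, since `f` has norm at most `1` in `V` and `f ≥
1`. A normalized evaluation is therefore the required `ξ` (`exists_almost_invariant`).

No invariant functional. Functionals on `V` are norm limits of functionals on `C(X)`, which are
dominated by finite measures. A generator has north-south dynamics, and orbits in `X` are infinite,
so any finite measure can be contracted to a point mass along a net (`exists_contracting`); this
also gives strong proximality. An invariant functional is thus within any `η` of some `c` times an
evaluation, and by minimality of the same `c` times every evaluation. Comparing points with
different values of `f` forces `c`, and then the functional, to be small.

Rosenthal property. For all but finitely many `g`, either `g⁻¹P` or its complement lies in one small
cylinder (`exists_null_family`), so `f ∘ g` is a constant plus a function of shrinking support. A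
Helly-type selection (`exists_subseq_cauchySeq`) then gives pointwise convergent subsequences of
absolutely convex combinations. Approximation and dominated convergence make bounded sequences of
`V` have weakly Cauchy subsequences, which excludes `ℓ₁`. -/

noncomputable section

open Filter Topology

/-! ### Words acting on the boundary -/

namespace Letter

theorem ne_bar_iff (s t : Letter) : t ≠ s.bar ↔ (s.1 = t.1 → s.2 = t.2) := by
  revert s t; decide

/-- Only two of the four letters are excluded. The letter found joins two reduced words without
cancellation. -/
theorem exists_between (s t : Letter) : ∃ r : Letter, r ≠ s.bar ∧ t ≠ r.bar := by
  revert s t; decide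

theorem ne_bar_self (s : Letter) : s ≠ s.bar := by
  revert s; decide

theorem bar_injective : Function.Injective Letter.bar :=
  Function.LeftInverse.injective Letter.bar_bar

end Letter

instance : Countable F2 := FreeGroup.toWord_injective.countable

namespace Boundary

/-- Two infinite words agree on their first `n` letters. -/
def Agree (n : ℕ) (ω ω' : Boundary) : Prop := ∀ i < n, ω.1 i = ω'.1 i

theorem Agree.mono {m n : ℕ} {ω ω' : Boundary} (h : Agree n ω ω') (hmn : m ≤ n) :
    Agree m ω ω' := fun i hi => h i (hi.trans_le hmn)

theorem isOpen_agree (n : ℕ) (ω : Boundary) : IsOpen {ω' | Agree n ω' ω} := by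
  have : {ω' : Boundary | Agree n ω' ω} =
      ⋂ i ∈ Finset.range n, (fun ω' : Boundary => ω'.1 i) ⁻¹' {ω.1 i} := by
    ext ω'; simp [Agree]
  rw [this]
  refine isOpen_biInter_finset fun i _ => ?_
  exact (isOpen_discrete _).preimage ((continuous_apply i).comp continuous_subtype_val)

theorem exists_agree_subset {U : Set Boundary} (hU : IsOpen U) {ω : Boundary} (hω : ω ∈ U) :
    ∃ n, ∀ ω', Agree n ω' ω → ω' ∈ U := by
  obtain ⟨V, hV, rfl⟩ := isOpen_induced_iff.mp hU
  obtain ⟨I, u, hu, hIV⟩ := isOpen_pi_iff.mp hV ω.1 hω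
  refine ⟨I.sup id + 1, fun ω' h => hIV fun i hi => ?_⟩
  have : i < I.sup id + 1 := Nat.lt_succ_of_le (Finset.le_sup (f := id) hi)
  rw [h i this]
  exact (hu i hi).2

theorem tendsto_of_eventually_agree {ι : Type*} {l : Filter ι} {u : ι → Boundary} {ω : Boundary}
    (h : ∀ n, ∀ᶠ i in l, Agree n (u i) ω) : Tendsto u l (𝓝 ω) := by
  refine tendsto_nhds.mpr fun U hU hω => ?_
  obtain ⟨n, hn⟩ := exists_agree_subset hU hω
  exact (h n).mono fun i hi => hn _ hi

/-- A clopen set of infinite words depends only on finitely many letters. -/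
theorem exists_agree_mem_iff (P : TopologicalSpace.Clopens Boundary) :
    ∃ n, ∀ ω ω', Agree n ω ω' → (ω ∈ P ↔ ω' ∈ P) := by
  have h (ω : Boundary) : ∃ n, ∀ ω', Agree n ω' ω → (ω' ∈ P ↔ ω ∈ P) := by
    by_cases hω : ω ∈ P
    · obtain ⟨n, hn⟩ := exists_agree_subset P.isClopen.isOpen hω
      exact ⟨n, fun ω' h => iff_of_true (hn ω' h) hω⟩
    · obtain ⟨n, hn⟩ := exists_agree_subset P.isClopen.compl.isOpen hω
      exact ⟨n, fun ω' h => iff_of_false (hn ω' h) hω⟩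
  choose n hn using h
  obtain ⟨t, ht⟩ := isCompact_univ.elim_finite_subcover (fun ω => {ω' | Agree (n ω) ω' ω})
    (fun ω => isOpen_agree _ _) (fun ω _ => Set.mem_iUnion.mpr ⟨ω, fun _ _ => rfl⟩)
  refine ⟨t.sup n, fun ω ω' h => ?_⟩
  obtain ⟨η, hη, hωη⟩ := Set.mem_iUnion₂.mp (ht (Set.mem_univ ω))
  have hωη : Agree (n η) ω η := hωη
  have h' : Agree (n η) ω' η := fun i hi =>
    (h i (hi.trans_le (Finset.le_sup hη))).symm.trans (hωη i hi)
  exact (hn η ω hωη).trans (hn η ω' h').symm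

theorem letterMul_of_ne {s : Letter} {ω : Boundary} (h : ω.1 0 ≠ s.bar) :
    (letterMul s ω).1 0 = s ∧ ∀ n, (letterMul s ω).1 (n + 1) = ω.1 n := by
  rw [letterMul, dif_neg h]
  exact ⟨rfl, fun _ => rfl⟩

theorem letterMul_of_eq {s : Letter} {ω : Boundary} (h : ω.1 0 = s.bar) (n : ℕ) :
    (letterMul s ω).1 n = ω.1 (n + 1) := by
  rw [letterMul, dif_pos h]
  rfl

theorem mk_singleton_smul (s : Letter) (ω : Boundary) :
    (FreeGroup.mk [s] : F2) • ω = letterMul s ω := by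
  obtain ⟨i, b⟩ := s
  rw [smul_def, FreeGroup.lift_mk]
  cases b <;> simp <;> rfl

theorem mk_cons_smul (s : Letter) (l : List Letter) (ω : Boundary) :
    (FreeGroup.mk (s :: l) : F2) • ω = letterMul s ((FreeGroup.mk l : F2) • ω) := by
  rw [← mk_singleton_smul, ← mul_smul, FreeGroup.mul_mk, List.singleton_append]

theorem mk_nil_smul (ω : Boundary) : (FreeGroup.mk [] : F2) • ω = ω := by
  rw [← FreeGroup.one_eq_mk, one_smul]

/-- A reduced word put in front of an infinite word without cancellation. -/
theorem getElem?_mk_smul (p : List Letter) (ω : Boundary)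
    (h : FreeGroup.IsReduced (p ++ [ω.1 0])) (i : ℕ) (hi : i ≤ p.length) :
    (p ++ [ω.1 0])[i]? = some (((FreeGroup.mk p : F2) • ω).1 i) := by
  induction p generalizing i with
  | nil =>
    obtain rfl : i = 0 := by simpa using hi
    simp [mk_nil_smul]
  | cons s p ih =>
    have hp : FreeGroup.IsReduced (p ++ [ω.1 0]) :=
      h.infix (List.infix_iff_prefix_suffix.mpr ⟨_, List.prefix_rfl, ⟨[s], rfl⟩⟩)
    have h0 := ih hp 0 (Nat.zero_le _)
    have hne : ((FreeGroup.mk p : F2) • ω).1 0 ≠ s.bar := by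
      rw [Letter.ne_bar_iff]
      cases hq : p ++ [ω.1 0] with
      | nil => simp at hq
      | cons t q =>
        rw [hq] at h0
        rw [List.cons_append, hq, FreeGroup.isReduced_cons_cons] at h
        simp only [List.getElem?_cons_zero, Option.some.injEq] at h0
        rw [← h0]
        exact h.1
    obtain ⟨e0, e1⟩ := letterMul_of_ne hne
    rw [mk_cons_smul]
    cases i with
    | zero => simp [e0]
    | succ i =>
      rw [e1, ← ih hp i (by simpa using hi)]
      simp

/-- The infinite word `ω` begins with the inverse of the word `l`. -/
def Cancels (l : List Letter) (ω : Boundary) : Prop :=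
  ∀ i < l.length, l[i]? = some (ω.1 (l.length - 1 - i)).bar

theorem Cancels.agree {l : List Letter} {ω ω' : Boundary} (h : Cancels l ω) (h' : Cancels l ω') :
    Agree l.length ω ω' := by
  intro i hi
  have h1 := h (l.length - 1 - i) (by omega)
  have h2 := h' (l.length - 1 - i) (by omega)
  rw [h1, Option.some.injEq] at h2
  have := Letter.bar_injective h2
  rwa [show l.length - 1 - (l.length - 1 - i) = i by omega] at this

/-- Letters of `l` act from the right end. Once one of them survives, reducedness of `l` prevents
any further cancellation; otherwise all of `l` is absorbed by the beginning of `ω`. -/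
theorem head_mk_smul_or_cancels (l : List Letter) (hl : FreeGroup.IsReduced l) (ω : Boundary) :
    l.head? = some (((FreeGroup.mk l : F2) • ω).1 0) ∨
      ((∀ k, ((FreeGroup.mk l : F2) • ω).1 k = ω.1 (k + l.length)) ∧ Cancels l ω) := by
  induction l with
  | nil => exact Or.inr ⟨fun k => by simp [mk_nil_smul], fun i hi => by simp at hi⟩
  | cons s l ih =>
    have hl' : FreeGroup.IsReduced l := hl.infix (List.infix_cons (List.infix_refl l))
    rw [mk_cons_smul]
    by_cases h0 : ((FreeGroup.mk l : F2) • ω).1 0 = s.bar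
    · rcases ih hl' with h | ⟨h, hc⟩
      · exfalso
        cases l with
        | nil => simp at h
        | cons t l =>
          simp only [List.head?_cons, Option.some.injEq] at h
          rw [FreeGroup.isReduced_cons_cons, ← Letter.ne_bar_iff] at hl
          exact hl.1 (h.trans h0)
      · refine Or.inr ⟨fun k => ?_, fun i hi => ?_⟩
        · rw [letterMul_of_eq h0, h, List.length_cons, add_right_comm, add_assoc]
        · cases i with
          | zero =>
            have := h 0
            rw [h0, zero_add] at this
            simp [← this, Letter.bar_bar]
          | succ i =>
            rw [List.length_cons] at hi
            rw [List.getElem?_cons_succ, hc i (by omega), List.length_cons,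
              show l.length + 1 - 1 - (i + 1) = l.length - 1 - i by omega]
    · left
      simp [(letterMul_of_ne h0).1]

/-- If `ω` does not begin with the inverse of `q ≠ []`, then `p q ω` begins with `p`. -/
theorem getElem?_mk_append_smul {p q : List Letter} (hq : q ≠ [])
    (h : FreeGroup.IsReduced (p ++ q)) {ω : Boundary} (hω : ¬ Cancels q ω) (i : ℕ)
    (hi : i < p.length) : p[i]? = some (((FreeGroup.mk (p ++ q) : F2) • ω).1 i) := by
  have hq' : FreeGroup.IsReduced q := h.infix (List.suffix_append p q).isInfix
  rcases head_mk_smul_or_cancels q hq' ω with h0 | h0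
  · cases q with
    | nil => exact absurd rfl hq
    | cons t q =>
      simp only [List.head?_cons, Option.some.injEq] at h0
      have hr : FreeGroup.IsReduced (p ++ [((FreeGroup.mk (t :: q) : F2) • ω).1 0]) := by
        rw [← h0]
        refine h.infix (List.IsPrefix.isInfix ⟨q, by simp⟩)
      have := getElem?_mk_smul p _ hr i hi.le
      rw [← mul_smul, FreeGroup.mul_mk] at this
      rw [← this, List.getElem?_append_left hi]
  · exact absurd h0.2 hω

/-- The translates of a clopen set form a null family: for all but finitely many `g`, the set
`g⁻¹ P` or its complement is contained in a single cylinder of a given length. -/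
theorem exists_null_family (P : TopologicalSpace.Clopens Boundary) :
    ∃ κ : F2 → Prop, ∀ n : ℕ, {g : F2 | ¬ ∀ ω ω' : Boundary, ¬ (g • ω ∈ P ↔ κ g) →
      ¬ (g • ω' ∈ P ↔ κ g) → Agree n ω ω'}.Finite := by
  obtain ⟨m, hm⟩ := exists_agree_mem_iff P
  -- Membership in `P` depends on `m` letters, so `κ g` asks whether the first `m` letters of `g`
  -- lead into `P`. This predicts `g • ω ∈ P` correctly unless `ω` cancels all the remaining letters
  -- of `g`, which determines at least `n` letters of `ω`. The extra `1` in the length bound keeps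
  -- that remainder nonempty.
  refine ⟨fun g => ∃ ω : Boundary, ω ∈ P ∧ ∀ i < m, g.toWord[i]? = some (ω.1 i), fun n => ?_⟩
  have hfin : {g : F2 | g.toWord.length < m + n + 1}.Finite :=
    (List.finite_length_lt Letter (m + n + 1)).preimage FreeGroup.toWord_injective.injOn
  refine hfin.subset fun g hg => ?_
  by_contra hlen
  simp only [Set.mem_ofPred_eq, not_lt] at hlen
  refine hg ?_
  have key (ω : Boundary) (hω : ¬ (g • ω ∈ P ↔ ∃ ω : Boundary, ω ∈ P ∧
      ∀ i < m, g.toWord[i]? = some (ω.1 i))) : Cancels (g.toWord.drop m) ω := by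
    by_contra hc
    apply hω
    have hne : g.toWord.drop m ≠ [] := by
      rw [← List.length_pos_iff, List.length_drop]; omega
    have hred : FreeGroup.IsReduced (g.toWord.take m ++ g.toWord.drop m) := by
      rw [List.take_append_drop]; exact FreeGroup.isReduced_toWord
    have hpre : ∀ i < m, g.toWord[i]? = some ((g • ω).1 i) := by
      intro i hi
      have := getElem?_mk_append_smul hne hred hc i (by rw [List.length_take]; omega)
      rw [List.take_append_drop, FreeGroup.mk_toWord] at this
      rw [← this, List.getElem?_take_of_lt hi]
    refine ⟨fun h => ⟨_, h, hpre⟩, fun ⟨η, hη, h⟩ => ?_⟩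
    refine (hm η (g • ω) fun i hi => ?_).mp hη
    have := (h i hi).symm.trans (hpre i hi)
    simpa using this
  intro ω ω' hω hω'
  refine ((key ω hω).agree (key ω' hω')).mono ?_
  rw [List.length_drop]
  omega

/-! ### Minimality and the dynamics of the generators -/

/-- The first `n` letters of an infinite word. -/
def pre (ω : Boundary) (n : ℕ) : List Letter := List.ofFn fun i : Fin n => ω.1 i

theorem isReduced_pre_append (ω : Boundary) (n : ℕ) (s : Letter)
    (hs : ∀ m, n = m + 1 → s ≠ (ω.1 m).bar) : FreeGroup.IsReduced (pre ω n ++ [s]) := by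
  rw [FreeGroup.IsReduced, List.isChain_iff_getElem]
  intro i hi
  have hlen : (pre ω n).length = n := by simp [pre]
  rw [List.length_append, hlen, List.length_singleton] at hi
  have e1 (j : ℕ) (hj : j < n) (hj' : j < (pre ω n ++ [s]).length) :
      (pre ω n ++ [s])[j] = ω.1 j := by
    rw [List.getElem_append_left (by omega)]
    simp only [pre, List.getElem_ofFn]
  rw [← Letter.ne_bar_iff, e1 i (by omega)]
  by_cases h : i + 1 < n
  · rw [e1 (i + 1) h]
    exact ω.2 i
  · rw [List.getElem_append_right (by omega)]
    simpa using hs i (by omega)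

/-- A joining letter between a prefix of `ω` and the word `η` makes the concatenation reduced, so
the prefix survives. It is taken of length `n + 1` so that it has a last letter even for `n = 0`. -/
theorem exists_smul_agree (ω η : Boundary) (n : ℕ) : ∃ g : F2, Agree n (g • η) ω := by
  obtain ⟨s, hs, hη⟩ := Letter.exists_between (ω.1 n) (η.1 0)
  obtain ⟨h0, -⟩ := letterMul_of_ne hη
  refine ⟨FreeGroup.mk (pre ω (n + 1)) * FreeGroup.mk [s], fun i hi => ?_⟩
  rw [mul_smul, mk_singleton_smul]
  have hlen : (pre ω (n + 1)).length = n + 1 := by simp [pre]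
  have := getElem?_mk_smul (pre ω (n + 1)) (letterMul s η)
    (isReduced_pre_append _ _ _ (by rintro m ⟨⟩; rwa [h0])) i (by omega)
  rw [List.getElem?_append_left (by omega)] at this
  have h1 : (pre ω (n + 1))[i]? = some (ω.1 i) := by
    rw [pre, List.getElem?_ofFn, dif_pos (by omega)]
  exact Option.some.inj (this.symm.trans h1)

instance : MulAction.IsMinimal F2 Boundary where
  dense_orbit η := by
    refine dense_iff_inter_open.mpr fun U hU ⟨ω, hω⟩ => ?_
    obtain ⟨n, hn⟩ := exists_agree_subset hU hω
    obtain ⟨g, hg⟩ := exists_smul_agree ω η n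
    exact ⟨g • η, hn _ hg, MulAction.mem_orbit _ _⟩

/-- The infinite word `s s s ⋯`. -/
def power (s : Letter) : Boundary := ⟨fun _ => s, fun _ => Letter.ne_bar_self s⟩

theorem of_smul_power (i : Fin 2) (b : Bool) :
    FreeGroup.of i • power (i, b) = power (i, b) := by
  have : (FreeGroup.of i : F2) • power (i, b) = letterMul (i, true) (power (i, b)) :=
    mk_singleton_smul (i, true) _
  rw [this]
  apply Subtype.ext
  funext n
  cases b with
  | false => rw [letterMul_of_eq rfl]; rfl
  | true =>
    have h := letterMul_of_ne (s := (i, true)) (ω := power (i, true)) (Letter.ne_bar_self _)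
    cases n with
    | zero => exact h.1
    | succ n => exact h.2 n

/-- If the letter of `ω` at position `k` is not the inverse generator, the last `k + 1` letters of a
power of the generator cannot all cancel, and all the letters before them survive. -/
theorem tendsto_of_pow_smul (i : Fin 2) {ω : Boundary} (hω : ω ≠ power (i, false)) :
    Tendsto (fun n : ℕ => (FreeGroup.of i ^ n : F2) • ω) atTop (𝓝 (power (i, true))) := by
  obtain ⟨k, hk⟩ : ∃ k, ω.1 k ≠ (i, false) := by
    by_contra! h
    exact hω (Subtype.ext (funext h))
  refine tendsto_of_eventually_agree fun n => ?_
  filter_upwards [eventually_ge_atTop (n + (k + 1))] with m hm j hj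
  have hrep (m : ℕ) : FreeGroup.IsReduced (List.replicate m ((i, true) : Letter)) :=
    List.isChain_replicate_of_rel _ fun _ => rfl
  obtain ⟨d, rfl⟩ := Nat.exists_eq_add_of_le hm
  have hpow : (FreeGroup.of i ^ (n + (k + 1) + d) : F2) = FreeGroup.mk
      (List.replicate (n + d) ((i, true) : Letter) ++ List.replicate (k + 1) (i, true)) := by
    rw [FreeGroup.of, FreeGroup.pow_mk, ← List.replicate_add,
      show n + (k + 1) + d = n + d + (k + 1) by ring]
    simp
  have hc : ¬ Cancels (List.replicate (k + 1) ((i, true) : Letter)) ω := by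
    intro hc
    have h0 := hc 0 (by simp)
    rw [List.length_replicate, Nat.sub_zero, Nat.add_sub_cancel, List.getElem?_replicate,
      if_pos (Nat.succ_pos k), Option.some.injEq] at h0
    exact hk ((Letter.bar_bar (ω.1 k)).symm.trans (congrArg Letter.bar h0.symm))
  have := getElem?_mk_append_smul (p := List.replicate (n + d) ((i, true) : Letter)) (by simp)
    (by rw [← List.replicate_add]; exact hrep _) hc j (by rw [List.length_replicate]; omega)
  change ((FreeGroup.of i ^ (n + (k + 1) + d) : F2) • ω).1 j = (i, true)
  rw [hpow]
  rw [List.getElem?_replicate, if_pos (by omega)] at this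
  exact (Option.some.inj this).symm

end Boundary

end

noncomputable section

open Filter Topology

/-! ### Pointwise convergent subsequences -/

theorem cauchySeq_of_forall_approx {S : ℕ → ℝ}
    (h : ∀ ε > 0, ∃ u : ℕ → ℝ, CauchySeq u ∧ ∀ᶠ k in atTop, |S k - u k| ≤ ε) : CauchySeq S := by
  rw [Metric.cauchySeq_iff]
  intro ε hε
  obtain ⟨u, hu, hSu⟩ := h (ε / 4) (by positivity)
  obtain ⟨N, hN⟩ := Metric.cauchySeq_iff.mp hu (ε / 4) (by positivity)
  obtain ⟨N', hN'⟩ := eventually_atTop.mp hSu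
  refine ⟨max N N', fun m hm n hn => ?_⟩
  have h1 := hN m (le_of_max_le_left hm) n (le_of_max_le_left hn)
  have h2 := hN' m (le_of_max_le_right hm)
  have h3 := hN' n (le_of_max_le_right hn)
  rw [Real.dist_eq] at h1 ⊢
  rw [abs_le] at h2 h3
  rw [abs_lt] at h1 ⊢
  constructor <;> linarith

/-- A countable product of compact intervals is sequentially compact; this stands in for a diagonal
argument. -/
theorem exists_subseq_tendsto_of_bounded {I : Type*} [Countable I] (x : ℕ → I → ℝ) (C : ℝ)
    (h : ∀ k i, |x k i| ≤ C) :
    ∃ ψ : ℕ → ℕ, StrictMono ψ ∧ ∃ L : I → ℝ, ∀ i, Tendsto (fun k => x (ψ k) i) atTop (𝓝 (L i)) := by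
  have hK : IsCompact (Set.univ.pi fun _ : I => Set.Icc (-C) C) :=
    isCompact_univ_pi fun _ => isCompact_Icc
  obtain ⟨L, -, ψ, hψ, hL⟩ := hK.tendsto_subseq (x := x) fun k i _ => abs_le.mp (h k i)
  exact ⟨ψ, hψ, L, fun i => (tendsto_pi_nhds.mp hL) i⟩

namespace Boundary

/-- The first `n` letters of an infinite word, as a tuple. -/
def restr (n : ℕ) (ω : Boundary) : Fin n → Letter := fun i => ω.1 i

theorem Agree.restr_eq {n : ℕ} {ω ω' : Boundary} (h : Agree n ω ω') : restr n ω = restr n ω' :=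
  funext fun i => h i i.2

theorem exists_injOn_restr (t : Finset Boundary) : ∃ n, Set.InjOn (restr n) t := by
  have h (p : Boundary × Boundary) : ∃ n, p.1 ≠ p.2 → ∀ m, n ≤ m → restr m p.1 ≠ restr m p.2 := by
    by_cases hp : p.1 = p.2
    · exact ⟨0, fun h => absurd hp h⟩
    · obtain ⟨i, hi⟩ : ∃ i, p.1.1 i ≠ p.2.1 i := by
        by_contra! h
        exact hp (Subtype.ext (funext h))
      exact ⟨i + 1, fun _ m hm h => hi (congrFun h ⟨i, hm⟩)⟩
  choose n hn using h
  refine ⟨(t ×ˢ t).sup n, fun ω hω ω' hω' he => ?_⟩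
  by_contra hne
  exact hn (ω, ω') hne _ (Finset.le_sup (Finset.mk_mem_product hω hω')) he

theorem abs_sum_mul_le {G : Type*} (c : G →₀ ℝ) (hc : ∑ g ∈ c.support, |c g| ≤ 1) {b : G → ℝ}
    {R : ℝ} (hR0 : 0 ≤ R) (hb : ∀ g, |b g| ≤ R) : |∑ g ∈ c.support, c g * b g| ≤ R := by
  refine (Finset.abs_sum_le_sum_abs _ _).trans ?_
  refine (Finset.sum_le_sum fun g _ => (abs_mul _ _).trans_le
    (mul_le_mul_of_nonneg_left (hb g) (abs_nonneg _))).trans ?_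
  rw [← Finset.sum_mul]
  exact (mul_le_mul_of_nonneg_right hc hR0).trans_eq (one_mul R)

/-! ### Selection of pointwise convergent subsequences for functions with shrinking supports. -/

section Helly

variable {G : Type*} {r : G → Boundary → ℝ}

/-- The support of `r g` is contained in one cylinder of length `n`, namely that of `C`. -/
def Hits (r : G → Boundary → ℝ) (n : ℕ) (C : Fin n → Letter) (g : G) : Prop :=
  (∀ ω ω', r g ω ≠ 0 → r g ω' ≠ 0 → Agree n ω ω') ∧ ∃ ω, r g ω ≠ 0 ∧ restr n ω = C

open Classical in
/-- The mass that the coefficients `c` give to the functions supported in the cylinder of `C`. -/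
def mass (r : G → Boundary → ℝ) (c : G →₀ ℝ) (n : ℕ) (C : Fin n → Letter) : ℝ :=
  ∑ g ∈ c.support with Hits r n C g, |c g|

theorem mass_nonneg (c : G →₀ ℝ) (n : ℕ) (C : Fin n → Letter) : 0 ≤ mass r c n C :=
  Finset.sum_nonneg fun _ _ => abs_nonneg _

/-- Distinct cylinders of one length are hit by disjoint sets of indices, because a function that
hits a cylinder is nonzero somewhere and has its support inside it. -/
theorem sum_mass_le (c : G →₀ ℝ) {n : ℕ} {t : Finset Boundary} (ht : Set.InjOn (restr n) t) :
    ∑ ω ∈ t, mass r c n (restr n ω) ≤ ∑ g ∈ c.support, |c g| := by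
  classical
  simp only [mass]
  rw [← Finset.sum_biUnion]
  · exact Finset.sum_le_sum_of_subset_of_nonneg
      (Finset.biUnion_subset.mpr fun _ _ => Finset.filter_subset _ _) fun _ _ _ => abs_nonneg _
  · intro ω hω ω' hω' hne
    refine Finset.disjoint_left.mpr fun g hg hg' => hne (ht hω hω' ?_)
    obtain ⟨h, η, hη, e⟩ := (Finset.mem_filter.mp hg).2
    obtain ⟨-, η', hη', e'⟩ := (Finset.mem_filter.mp hg').2
    rw [← e, ← e', (h η η' hη hη').restr_eq]

theorem mass_le (c : G →₀ ℝ) (n : ℕ) (C : Fin n → Letter) :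
    mass r c n C ≤ ∑ g ∈ c.support, |c g| := by
  classical
  exact Finset.sum_le_sum_of_subset_of_nonneg (Finset.filter_subset _ _) fun _ _ _ => abs_nonneg _

/-- Outside `E`, a function that does not vanish at `ω` has its support in the cylinder of `ω`, so
only the mass of that cylinder contributes to the error. -/
theorem abs_sum_sub_le {R : ℝ} (hR : ∀ g ω, |r g ω| ≤ R) (c : G →₀ ℝ) {n : ℕ} {E : Finset G}
    (hE : ∀ g ∉ E, ∀ ω ω', r g ω ≠ 0 → r g ω' ≠ 0 → Agree n ω ω') (ω : Boundary) :
    |∑ g ∈ c.support, c g * r g ω - ∑ g ∈ E, c g * r g ω| ≤ mass r c n (restr n ω) * R := by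
  classical
  have h1 : ∑ g ∈ E, c g * r g ω = ∑ g ∈ c.support with g ∈ E, c g * r g ω := by
    rw [← Finset.sum_filter_of_ne (s := E) (p := fun g => g ∈ c.support)]
    · exact Finset.sum_congr (by ext g; simp [and_comm]) fun _ _ => rfl
    · intro g _ hg
      exact Finsupp.mem_support_iff.mpr (left_ne_zero_of_mul hg)
  rw [h1, ← Finset.sum_filter_add_sum_filter_not c.support (fun g => g ∈ E), add_sub_cancel_left,
    ← Finset.sum_filter_of_ne (p := fun g => Hits r n (restr n ω) g)]
  · rw [mass, Finset.sum_mul]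
    refine (Finset.abs_sum_le_sum_abs _ _).trans ?_
    refine (Finset.sum_le_sum fun g _ => ?_).trans (Finset.sum_le_sum_of_subset_of_nonneg ?_ ?_)
    · rw [abs_mul]
      exact mul_le_mul_of_nonneg_left (hR g ω) (abs_nonneg _)
    · intro g hg
      rw [Finset.mem_filter, Finset.mem_filter] at hg
      exact Finset.mem_filter.mpr ⟨hg.1.1, hg.2⟩
    · intro g _ _
      exact mul_nonneg (abs_nonneg _) ((abs_nonneg _).trans (hR g ω))
  · intro g hg hne
    exact ⟨hE g (Finset.mem_filter.mp hg).2, ω, right_ne_zero_of_mul hne, rfl⟩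

/-- A form of Helly's selection theorem: if the functions `r g` are uniformly bounded and their
supports shrink, then sequences of absolutely convex combinations of them have pointwise convergent
subsequences. -/
theorem exists_subseq_cauchySeq [Countable G] {ι : Type*} [Countable ι] {R : ℝ}
    (hR0 : 0 ≤ R) (hR : ∀ g ω, |r g ω| ≤ R)
    (hnull : ∀ n, {g | ¬ ∀ ω ω', r g ω ≠ 0 → r g ω' ≠ 0 → Agree n ω ω'}.Finite)
    (c : ℕ → ι → G →₀ ℝ) (hc : ∀ k i, ∑ g ∈ (c k i).support, |c k i g| ≤ 1) :
    ∃ ψ : ℕ → ℕ, StrictMono ψ ∧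
      ∀ i ω, CauchySeq fun k => ∑ g ∈ (c (ψ k) i).support, c (ψ k) i g * r g ω := by
  have hcle (k : ℕ) (i : ι) (g : G) : |c k i g| ≤ 1 := by
    by_cases hg : g ∈ (c k i).support
    · exact (Finset.single_le_sum (f := fun g => |c k i g|) (fun _ _ => abs_nonneg _) hg).trans
        (hc k i)
    · rw [Finsupp.notMem_support_iff.mp hg]; simp
  -- The first extraction makes every coefficient and every cylinder mass converge.
  obtain ⟨ψ, hψ, L, hL⟩ := exists_subseq_tendsto_of_bounded
    (I := ι × (G ⊕ Σ n : ℕ, (Fin n → Letter)))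
    (fun k p => Sum.elim (fun g => c k p.1 g) (fun C : Σ n : ℕ, (Fin n → Letter) =>
      mass r (c k p.1) C.1 C.2) p.2) 1
    (by
      rintro k ⟨i, g | C⟩
      · exact hcle k i g
      · exact (abs_of_nonneg (mass_nonneg _ _ _)).trans_le ((mass_le _ _ _).trans (hc k i)))
  have hLc (i : ι) (g : G) : Tendsto (fun k => c (ψ k) i g) atTop (𝓝 (L (i, Sum.inl g))) :=
    hL (i, Sum.inl g)
  set m : ι → (n : ℕ) → (Fin n → Letter) → ℝ := fun i n C => L (i, Sum.inr ⟨n, C⟩) with hm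
  have hLm (i : ι) (n : ℕ) (C : Fin n → Letter) :
      Tendsto (fun k => mass r (c (ψ k) i) n C) atTop (𝓝 (m i n C)) := hL (i, Sum.inr ⟨n, C⟩)
  -- `A i ε` collects the points all of whose cylinders keep limit mass at least `ε`. Cylinders of
  -- long enough length separate finitely many points, and the total mass is at most `1`, so there
  -- are at most `1 / ε` such points.
  let A : ι → ℝ → Set Boundary := fun i ε => {ω | ∀ n, ε ≤ m i n (restr n ω)}
  have hA (i : ι) (ε : ℝ) (hε : 0 < ε) : (A i ε).Finite := by
    by_contra hinf
    obtain ⟨M, hM⟩ := exists_nat_gt (1 / ε)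
    obtain ⟨t, htA, htc⟩ := (show (A i ε).Infinite from hinf).exists_subset_card_eq M
    obtain ⟨n, hn⟩ := exists_injOn_restr t
    have h1 : ∑ ω ∈ t, m i n (restr n ω) ≤ 1 :=
      le_of_tendsto (tendsto_finsetSum t fun ω _ => hLm i n (restr n ω))
        (Eventually.of_forall fun k => (sum_mass_le _ hn).trans (hc _ _))
    have h2 : (M : ℝ) * ε ≤ ∑ ω ∈ t, m i n (restr n ω) := by
      rw [← htc, ← nsmul_eq_mul]
      exact Finset.card_nsmul_le_sum _ _ _ fun ω hω => htA hω n
    rw [div_lt_iff₀ hε] at hM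
    linarith
  let B : Set Boundary := ⋃ i, ⋃ j : ℕ, A i (1 / ((j : ℝ) + 1))
  have hB : B.Countable := Set.countable_iUnion fun i => Set.countable_iUnion fun j =>
    (hA i _ (by positivity)).countable
  have : Countable B := hB.to_subtype
  have hSle (k : ℕ) (i : ι) (ω : Boundary) :
      |∑ g ∈ (c k i).support, c k i g * r g ω| ≤ R :=
    abs_sum_mul_le _ (hc k i) hR0 fun g => hR g ω
  -- The second extraction forces convergence at the countably many points of `B`. At any other
  -- point some cylinder has small limit mass, and up to a small error the sum reduces to finitely
  -- many terms with convergent coefficients.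
  obtain ⟨χ, hχ, L', hL'⟩ := exists_subseq_tendsto_of_bounded (I := ι × B)
    (fun k p => ∑ g ∈ (c (ψ k) p.1).support, c (ψ k) p.1 g * r g p.2.1) R
    (fun k p => hSle _ _ _)
  refine ⟨ψ ∘ χ, hψ.comp hχ, fun i ω => ?_⟩
  by_cases hω : ω ∈ B
  · exact (hL' (i, ⟨ω, hω⟩)).cauchySeq
  · refine cauchySeq_of_forall_approx fun ε hε => ?_
    have hRpos : 0 < |R| + 1 := by positivity
    obtain ⟨j, hj⟩ := exists_nat_one_div_lt (div_pos hε hRpos)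
    have hωA : ω ∉ A i (1 / ((j : ℝ) + 1)) := fun h =>
      hω (Set.mem_iUnion.mpr ⟨i, Set.mem_iUnion.mpr ⟨j, h⟩⟩)
    obtain ⟨n, hn⟩ : ∃ n, m i n (restr n ω) < 1 / ((j : ℝ) + 1) := by
      by_contra! h
      exact hωA h
    refine ⟨fun k => ∑ g ∈ (hnull n).toFinset, c ((ψ ∘ χ) k) i g * r g ω, ?_, ?_⟩
    · exact (tendsto_finsetSum _ fun g _ =>
        ((hLc i g).comp hχ.tendsto_atTop).mul_const (r g ω)).cauchySeq
    · filter_upwards [((hLm i n (restr n ω)).comp hχ.tendsto_atTop).eventually_lt_const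
        (hn.trans hj)] with k hk
      refine (abs_sum_sub_le hR _ (n := n) (fun g hg => ?_) ω).trans ?_
      · by_contra h
        exact hg ((hnull n).mem_toFinset.mpr h)
      · calc mass r (c ((ψ ∘ χ) k) i) n (restr n ω) * R
            ≤ mass r (c ((ψ ∘ χ) k) i) n (restr n ω) * (|R| + 1) :=
              mul_le_mul_of_nonneg_left ((le_abs_self R).trans (by linarith)) (mass_nonneg _ _ _)
          _ ≤ ε / (|R| + 1) * (|R| + 1) := mul_le_mul_of_nonneg_right hk.le hRpos.le
          _ = ε := div_mul_cancel₀ _ hRpos.ne'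

end Helly

open Classical in
/-- The orbit of a two-valued continuous function on the boundary is tame, together with its
absolutely convex hull. -/
theorem exists_subseq_cauchySeq_orbit (P : TopologicalSpace.Clopens Boundary) (p q : ℝ)
    {ι : Type*} [Countable ι] (c : ℕ → ι → F2 →₀ ℝ)
    (hc : ∀ k i, ∑ g ∈ (c k i).support, |c k i g| ≤ 1) :
    ∃ ψ : ℕ → ℕ, StrictMono ψ ∧ ∀ i (ω : Boundary), CauchySeq fun k =>
      ∑ g ∈ (c (ψ k) i).support, c (ψ k) i g * (if g • ω ∈ P then p else q) := by
  obtain ⟨κ, hκ⟩ := exists_null_family P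
  have hR0 : 0 ≤ |p| + |q| := by positivity
  have hite (Q : Prop) : |if Q then p else q| ≤ |p| + |q| := by
    split_ifs
    · linarith [abs_nonneg q]
    · linarith [abs_nonneg p]
  -- Each translate splits into the constant given by `κ g` and a remainder of shrinking support.
  -- The combinations of the constants are made to converge before the selection theorem is applied
  -- to the remainders.
  obtain ⟨ψ, hψ, L, hL⟩ := exists_subseq_tendsto_of_bounded
    (fun k i => ∑ g ∈ (c k i).support, c k i g * (if κ g then p else q)) (|p| + |q|)
    (fun k i => abs_sum_mul_le _ (hc k i) hR0 fun g => hite _)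
  obtain ⟨χ, hχ, h⟩ := exists_subseq_cauchySeq
    (r := fun (g : F2) (ω : Boundary) =>
      (if g • ω ∈ P then p else q) - (if κ g then p else q)) (R := |p| + |q| + (|p| + |q|))
    (by positivity) (fun g ω => (abs_sub _ _).trans (add_le_add (hite _) (hite _)))
    (fun n => (hκ n).subset fun g hg hg' => hg fun ω ω' h h' => hg' ω ω'
      (fun e => h (by simp [e])) (fun e => h' (by simp [e])))
    (fun k => c (ψ k)) (fun k => hc (ψ k))
  refine ⟨ψ ∘ χ, hψ.comp hχ, fun i ω => ?_⟩
  have := (h i ω).add ((hL i).comp hχ.tendsto_atTop).cauchySeq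
  convert this using 2 with k
  simp [mul_sub]

end Boundary

end

noncomputable section

open Filter Topology

/-! ### Sums of Banach spaces -/

section LpSum

variable {E : ℕ → Type*} [∀ n, NormedAddCommGroup (E n)]

theorem lp_two_separableSpace [∀ n, TopologicalSpace.SeparableSpace (E n)] :
    TopologicalSpace.SeparableSpace (lp E 2) := by
  rw [← TopologicalSpace.isSeparable_univ_iff]
  let S : Finset ℕ → Set (lp E 2) := fun s =>
    Set.range fun a : (∀ i : s, E i) => ∑ i : s, lp.single 2 i.1 (a i)
  have hS : TopologicalSpace.IsSeparable (⋃ s, S s) := by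
    refine TopologicalSpace.IsSeparable.iUnion fun s => TopologicalSpace.isSeparable_range ?_
    exact continuous_finsetSum _ fun i _ => (lp.isometry_single i.1).continuous.comp
      (continuous_apply i)
  refine hS.closure.mono fun f _ => ?_
  refine mem_closure_of_tendsto (lp.hasSum_single (by simp) f) (Eventually.of_forall fun s => ?_)
  refine Set.mem_iUnion.mpr ⟨s, fun i => f i.1, ?_⟩
  exact Finset.sum_coe_sort s fun i => lp.single 2 i (f i)

theorem lp_two_norm_sq_eq (f : lp E 2) (s : Finset ℕ) :
    ‖f‖ ^ 2 = ∑ i ∈ s, ‖f i‖ ^ 2 + ‖f - ∑ i ∈ s, lp.single 2 i (f i)‖ ^ 2 := by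
  have := lp.norm_sub_norm_compl_sub_single (p := 2) (by simp) f s
  simp only [ENNReal.toReal_ofNat, Real.rpow_two] at this
  linarith

variable [∀ n, NormedSpace ℝ (E n)]

/-- The tails of a functional on an `ℓ²`-sum tend to zero in norm. -/
theorem exists_finset_abs_sub_sum_single_le (Φ : StrongDual ℝ (lp E 2)) {ε : ℝ} (hε : 0 < ε) :
    ∃ s : Finset ℕ, ∀ y : lp E 2, |Φ y - ∑ i ∈ s, Φ (lp.single 2 i (y i))| ≤ ε * ‖y‖ := by
  -- Let `z` almost norm `Φ`, cut down to a finite set `s`. Adding a vector of norm `τ` supported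
  -- off `s` raises the norm only by order `τ²`, while a large tail of `Φ` would raise the value by
  -- order `τ`. The defect `τ * ε / 2` and `‖Φ‖ * τ ≤ ε` make the two errors sum to at most `τ * ε`.
  set τ : ℝ := ε / (‖Φ‖ + 1) with hτdef
  have hΦ1 : 0 < ‖Φ‖ + 1 := by positivity
  have hτ : 0 < τ := by positivity
  have hτΦ : ‖Φ‖ * τ ≤ ε := by
    rw [hτdef, ← mul_div_assoc, div_le_iff₀ hΦ1]
    nlinarith [norm_nonneg Φ]
  obtain ⟨z, hz, hΦz⟩ : ∃ z : lp E 2, ‖z‖ ≤ 1 ∧ ‖Φ‖ - τ * ε / 2 < Φ z := by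
    by_contra! h
    have : ‖Φ‖ ≤ max (‖Φ‖ - τ * ε / 2) 0 := by
      refine ContinuousLinearMap.opNorm_le_of_unit_norm (le_max_right _ _) fun x hx => ?_
      rw [Real.norm_eq_abs]
      refine le_max_of_le_left (abs_le.mpr ⟨?_, h x hx.le⟩)
      have := h (-x) (by rw [norm_neg, hx])
      rw [map_neg] at this
      linarith
    rcases le_max_iff.mp this with h' | h'
    · linarith [mul_pos hτ hε]
    · have h0 := h 0 (by simp)
      have : ‖Φ‖ = 0 := le_antisymm h' (norm_nonneg _)
      rw [map_zero, this] at h0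
      linarith [mul_pos hτ hε]
  obtain ⟨s, hs⟩ : ∃ s : Finset ℕ, ‖Φ‖ - τ * ε / 2 < Φ (∑ i ∈ s, lp.single 2 i (z i)) :=
    (((Φ.continuous.tendsto z).comp (lp.hasSum_single (by simp) z)).eventually_const_lt hΦz).exists
  refine ⟨s, ?_⟩
  have key (y : lp E 2) : Φ (y - ∑ i ∈ s, lp.single 2 i (y i)) ≤ ε * ‖y‖ := by
    set y' := y - ∑ i ∈ s, lp.single 2 i (y i) with hy'
    have hy'le : ‖y'‖ ≤ ‖y‖ := by
      refine (pow_le_pow_iff_left₀ (norm_nonneg _) (norm_nonneg _) two_ne_zero).mp ?_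
      rw [lp_two_norm_sq_eq y s]
      exact le_add_of_nonneg_left (Finset.sum_nonneg fun _ _ => by positivity)
    rcases (norm_nonneg y').eq_or_lt with h0 | hpos
    · rw [norm_eq_zero.mp h0.symm, map_zero]
      positivity
    have hsum (w : lp E 2) (j : ℕ) :
        (∑ i ∈ s, lp.single 2 i (w i) : lp E 2) j = if j ∈ s then w j else 0 := by
      simp only [lp.coeFn_single, lp.coeFn_sum, Finset.sum_apply, Finset.sum_pi_single]
    set t := τ / ‖y'‖ with ht
    have htpos : 0 < t := by positivity
    set f : lp E 2 := (∑ i ∈ s, lp.single 2 i (z i)) + t • y' with hf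
    have hfs : ∀ j ∈ s, f j = z j := by
      intro j hj
      rw [hf, lp.coeFn_add, Pi.add_apply, hsum, if_pos hj, lp.coeFn_smul, Pi.smul_apply, hy',
        lp.coeFn_sub, Pi.sub_apply, hsum, if_pos hj, sub_self, smul_zero, add_zero]
    have hfsum : ∑ i ∈ s, lp.single 2 i (f i) = ∑ i ∈ s, lp.single 2 i (z i) :=
      Finset.sum_congr rfl fun i hi => by rw [hfs i hi]
    have hnorm : ‖f‖ ^ 2 ≤ 1 + τ ^ 2 := by
      rw [lp_two_norm_sq_eq f s, hfsum, hf, add_sub_cancel_left, ← hf, norm_smul, ht,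
        Real.norm_of_nonneg htpos.le, div_mul_cancel₀ _ hpos.ne']
      have h1 : ∑ i ∈ s, ‖f i‖ ^ 2 = ∑ i ∈ s, ‖z i‖ ^ 2 :=
        Finset.sum_congr rfl fun i hi => by rw [hfs i hi]
      have h2 : ∑ i ∈ s, ‖z i‖ ^ 2 ≤ 1 := by
        have := lp_two_norm_sq_eq z s
        have hz2 : ‖z‖ ^ 2 ≤ 1 := pow_le_one₀ (norm_nonneg _) hz
        nlinarith [sq_nonneg ‖z - ∑ i ∈ s, lp.single 2 i (z i)‖]
      linarith
    have hnorm' : ‖f‖ ≤ 1 + τ ^ 2 / 2 := by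
      refine (pow_le_pow_iff_left₀ (norm_nonneg _) (by positivity) two_ne_zero).mp ?_
      nlinarith [sq_nonneg (τ ^ 2)]
    have h3 : Φ f ≤ ‖Φ‖ * (1 + τ ^ 2 / 2) :=
      (le_abs_self _).trans ((Φ.le_opNorm f).trans
        (mul_le_mul_of_nonneg_left hnorm' (norm_nonneg _)))
    rw [hf, map_add, map_smul, smul_eq_mul] at h3
    have h4 : t * Φ y' ≤ τ * ε := by
      nlinarith [mul_le_mul_of_nonneg_left hτΦ hτ.le]
    rw [ht, div_mul_eq_mul_div, div_le_iff₀ hpos, mul_assoc, mul_le_mul_iff_right₀ hτ] at h4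
    exact h4.trans (mul_le_mul_of_nonneg_left hy'le hε.le)
  intro y
  have h1 := key y
  have h2 := key (-y)
  have e : -y - ∑ i ∈ s, lp.single 2 i ((-y : lp E 2) i) =
      -(y - ∑ i ∈ s, lp.single 2 i (y i)) := by
    simp only [lp.coeFn_neg, Pi.neg_apply, lp.single_neg, Finset.sum_neg_distrib]
    abel
  rw [e, map_neg, norm_neg] at h2
  rw [map_sub, map_sum] at h1 h2
  exact abs_le.mpr ⟨by linarith, h1⟩

end LpSum

/-! ### A criterion for Rosenthal spaces -/

/-- The functional on `ℓ¹` given by a bounded sequence. -/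
theorem exists_dual_lp_one (s : ℕ → ℝ) (hs : ∀ k, |s k| ≤ 1) :
    ∃ Λ : StrongDual ℝ (lp (fun _ : ℕ => ℝ) 1), ∀ k, Λ (lp.single 1 k 1) = s k := by
  have hsum (x : lp (fun _ : ℕ => ℝ) 1) : Summable fun k => ‖x k‖ := by
    simpa using (lp.memℓp x).summable (by simp)
  have hle (x : lp (fun _ : ℕ => ℝ) 1) (k : ℕ) : ‖s k * x k‖ ≤ ‖x k‖ := by
    rw [norm_mul]
    exact mul_le_of_le_one_left (norm_nonneg _) (hs k)
  have hsum' (x : lp (fun _ : ℕ => ℝ) 1) : Summable fun k => s k * x k :=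
    Summable.of_norm_bounded (hsum x) (hle x)
  let Λ₀ : lp (fun _ : ℕ => ℝ) 1 →ₗ[ℝ] ℝ :=
    { toFun := fun x => ∑' k, s k * x k
      map_add' := fun x y => by
        rw [← (hsum' x).tsum_add (hsum' y)]
        exact tsum_congr fun k => by rw [lp.coeFn_add, Pi.add_apply, mul_add]
      map_smul' := fun a x => by
        rw [RingHom.id_apply, smul_eq_mul, ← tsum_mul_left]
        exact tsum_congr fun k => by
          rw [lp.coeFn_smul, Pi.smul_apply, smul_eq_mul]; ring }
  refine ⟨Λ₀.mkContinuous 1 fun x => ?_, fun k => ?_⟩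
  · rw [one_mul, lp.norm_eq_tsum_rpow (by simp)]
    simp only [ENNReal.toReal_one, Real.rpow_one, div_one]
    refine (norm_tsum_le_tsum_norm
      ((hsum x).of_nonneg_of_le (fun _ => norm_nonneg _) (hle x))).trans ?_
    exact ((hsum x).of_nonneg_of_le (fun _ => norm_nonneg _) (hle x)).tsum_le_tsum (hle x) (hsum x)
  · change ∑' j, s j * (lp.single 1 k (1 : ℝ) : lp (fun _ : ℕ => ℝ) 1) j = s k
    rw [tsum_eq_single k]
    · rw [lp.single_apply_self, mul_one]
    · intro j hj
      rw [lp.single_apply_ne _ _ _ hj, mul_zero]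

/-- A Banach space in which bounded sequences have weakly Cauchy subsequences is Rosenthal. -/
theorem isRosenthal_of_weaklyCauchy {V : Type*} [NormedAddCommGroup V] [NormedSpace ℝ V]
    (h : ∀ v : ℕ → V, (∀ k, ‖v k‖ ≤ 1) → ∃ ψ : ℕ → ℕ, StrictMono ψ ∧
      ∀ φ : StrongDual ℝ V, CauchySeq fun k => φ (v (ψ k))) : IsRosenthal V := by
  rintro ⟨T, c, hc, hT⟩
  set C : ℝ := ‖T‖ + 1 with hC
  have hCpos : 0 < C := by positivity
  obtain ⟨ψ, hψ, hψC⟩ := h (fun k => C⁻¹ • T (lp.single 1 k 1)) fun k => by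
    rw [norm_smul, norm_inv, Real.norm_of_nonneg hCpos.le, inv_mul_le_iff₀ hCpos, mul_one]
    refine (T.le_opNorm _).trans ?_
    rw [lp.norm_single (by simp), norm_one, mul_one, hC]
    linarith
  -- Alternating signs along the subsequence, and `0` off it, define a functional on `ℓ¹`. Carried
  -- to the range of `T` and extended by Hahn–Banach, it takes values on the subsequence that jump
  -- by `2 * C⁻¹` at each step.
  obtain ⟨Λ, hΛ⟩ := exists_dual_lp_one (Function.extend ψ (fun k => (-1 : ℝ) ^ k) 0) fun k => by
    by_cases hk : ∃ i, ψ i = k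
    · obtain ⟨i, rfl⟩ := hk
      rw [hψ.injective.extend_apply]
      simp
    · rw [Function.extend_apply' _ _ _ hk]
      simp
  have hinj : Function.Injective T := by
    refine (injective_iff_map_eq_zero T).mpr fun x hx => ?_
    have := hT x
    rw [hx, norm_zero] at this
    exact norm_eq_zero.mp (le_antisymm (by nlinarith [norm_nonneg x]) (norm_nonneg _))
  let e := LinearEquiv.ofInjective (T : lp (fun _ : ℕ => ℝ) 1 →ₗ[ℝ] V) hinj
  have hbound (y : LinearMap.range (T : lp (fun _ : ℕ => ℝ) 1 →ₗ[ℝ] V)) :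
      ‖(Λ.toLinearMap ∘ₗ e.symm.toLinearMap) y‖ ≤ (‖Λ‖ * c⁻¹) * ‖y‖ := by
    refine (Λ.le_opNorm _).trans ?_
    rw [mul_assoc]
    refine mul_le_mul_of_nonneg_left ?_ (norm_nonneg _)
    rw [← div_eq_inv_mul, le_div_iff₀' hc]
    refine (hT _).trans_eq ?_
    have : ((e (e.symm y) : LinearMap.range (T : lp (fun _ : ℕ => ℝ) 1 →ₗ[ℝ] V)) : V) =
      T (e.symm y) := rfl
    change ‖T (e.symm y)‖ = ‖y‖
    rw [← this, e.apply_symm_apply]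
    rfl
  obtain ⟨φ, hφ, -⟩ := exists_extension_norm_eq _
    ((Λ.toLinearMap ∘ₗ e.symm.toLinearMap).mkContinuous _ hbound)
  have hφψ (k : ℕ) : φ (C⁻¹ • T (lp.single 1 (ψ k) 1)) = C⁻¹ * (-1) ^ k := by
    rw [map_smul, smul_eq_mul]
    congr 1
    have h1 := hφ (e (lp.single 1 (ψ k) 1))
    have h2 : Λ (lp.single 1 (ψ k) 1) = (-1) ^ k := by
      rw [hΛ, hψ.injective.extend_apply]
    rw [← h2]
    refine h1.trans ?_
    change Λ (e.symm (e _)) = _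
    rw [e.symm_apply_apply]
  have hcau := hψC φ
  simp only [hφψ] at hcau
  obtain ⟨N, hN⟩ := Metric.cauchySeq_iff'.mp hcau (C⁻¹) (by positivity)
  have := hN (N + 1) (by omega)
  rw [Real.dist_eq, pow_succ, show C⁻¹ * ((-1) ^ N * -1) - C⁻¹ * (-1) ^ N =
    -(2 * C⁻¹) * (-1 : ℝ) ^ N by ring, abs_mul, abs_pow, abs_neg, abs_neg, abs_one, one_pow,
    mul_one, abs_of_pos (by positivity)] at this
  linarith [inv_pos.mpr hCpos]

end

noncomputable section

open Filter Topology

/-! ### The Davis–Figiel–Johnson–Pełczyński space of a bounded disk -/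

/-- A nonempty bounded convex symmetric subset of a normed space. -/
structure BoundedDisk (A : Type*) [NormedAddCommGroup A] [NormedSpace ℝ A] where
  carrier : Set A
  convex : Convex ℝ carrier
  neg_mem : ∀ a ∈ carrier, -a ∈ carrier
  radius : ℝ
  norm_le : ∀ a ∈ carrier, ‖a‖ ≤ radius
  nonempty : carrier.Nonempty

namespace BoundedDisk

variable {A : Type*} [NormedAddCommGroup A] [NormedSpace ℝ A] (D : BoundedDisk A)

theorem zero_mem : (0 : A) ∈ D.carrier := by
  obtain ⟨a, ha⟩ := D.nonempty
  have := D.convex ha (D.neg_mem a ha) (a := 1 / 2) (b := 1 / 2) (by norm_num) (by norm_num)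
    (by norm_num)
  simpa using this

theorem smul_mem {t : ℝ} (h0 : 0 ≤ t) (h1 : t ≤ 1) {a : A} (ha : a ∈ D.carrier) :
    t • a ∈ D.carrier :=
  D.convex.smul_mem_of_zero_mem D.zero_mem ha ⟨h0, h1⟩

theorem radius_nonneg : 0 ≤ D.radius := by
  obtain ⟨a, ha⟩ := D.nonempty
  exact (norm_nonneg a).trans (D.norm_le a ha)

/-- The set `2ⁿ W + 2⁻ⁿ B`. -/
def fatten (n : ℕ) : Set A := dfjpSet D.carrier n

theorem mem_fatten_iff {n : ℕ} {a : A} :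
    a ∈ D.fatten n ↔ ∃ w ∈ D.carrier, ‖a - (2 : ℝ) ^ n • w‖ ≤ ((2 : ℝ) ^ n)⁻¹ := by
  have hpos : (0 : ℝ) < ((2 : ℝ) ^ n)⁻¹ := by positivity
  rw [fatten, dfjpSet, smul_unitClosedBall_of_nonneg hpos.le]
  constructor
  · rintro ⟨_, ⟨w, hw, rfl⟩, b, hb, rfl⟩
    refine ⟨w, hw, ?_⟩
    simpa using hb
  · rintro ⟨w, hw, h⟩
    exact ⟨_, ⟨w, hw, rfl⟩, a - (2 : ℝ) ^ n • w, by simpa using h, by simp⟩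

theorem convex_fatten (n : ℕ) : Convex ℝ (D.fatten n) :=
  (D.convex.smul _).add ((convex_closedBall _ _).smul _)

theorem neg_mem_fatten {n : ℕ} {a : A} (ha : a ∈ D.fatten n) : -a ∈ D.fatten n := by
  rw [mem_fatten_iff] at ha ⊢
  obtain ⟨w, hw, h⟩ := ha
  refine ⟨-w, D.neg_mem w hw, ?_⟩
  rwa [smul_neg, ← neg_sub', norm_neg]

theorem balanced_fatten (n : ℕ) : Balanced ℝ (D.fatten n) :=
  (balanced_iff_neg_mem (D.convex_fatten n)).mpr fun _ => D.neg_mem_fatten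

theorem ball_subset_fatten (n : ℕ) : Metric.ball 0 ((2 : ℝ) ^ n)⁻¹ ⊆ D.fatten n := fun a ha =>
  D.mem_fatten_iff.mpr ⟨0, D.zero_mem, by
    rw [smul_zero, sub_zero]
    exact (mem_ball_zero_iff.mp ha).le⟩

theorem absorbent_fatten (n : ℕ) : Absorbent ℝ (D.fatten n) :=
  (absorbent_ball_zero (by positivity)).mono (D.ball_subset_fatten n)

/-- A bound for the elements of `2ⁿ W + 2⁻ⁿ B`. -/
def fattenRadius (n : ℕ) : ℝ := (2 : ℝ) ^ n * D.radius + ((2 : ℝ) ^ n)⁻¹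

theorem fattenRadius_pos (n : ℕ) : 0 < D.fattenRadius n := by
  have := D.radius_nonneg
  rw [fattenRadius]
  positivity

theorem fatten_subset_closedBall (n : ℕ) :
    D.fatten n ⊆ Metric.closedBall 0 (D.fattenRadius n) := fun a ha => by
  obtain ⟨w, hw, h⟩ := D.mem_fatten_iff.mp ha
  rw [mem_closedBall_zero_iff, fattenRadius]
  have h1 : ‖(2 : ℝ) ^ n • w‖ ≤ (2 : ℝ) ^ n * D.radius := by
    rw [norm_smul, Real.norm_of_nonneg (by positivity)]
    exact mul_le_mul_of_nonneg_left (D.norm_le w hw) (by positivity)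
  calc ‖a‖ = ‖(2 : ℝ) ^ n • w + (a - (2 : ℝ) ^ n • w)‖ := by rw [add_sub_cancel]
    _ ≤ _ := (norm_add_le _ _).trans (add_le_add h1 h)

theorem norm_le_mul_gauge (n : ℕ) (a : A) :
    ‖a‖ ≤ D.fattenRadius n * gauge (D.fatten n) a := by
  have := le_gauge_of_subset_closedBall (x := a) (D.absorbent_fatten n) (D.fattenRadius_pos n).le
    (D.fatten_subset_closedBall n)
  rwa [div_le_iff₀' (D.fattenRadius_pos n)] at this

theorem gauge_le_mul_norm (n : ℕ) (a : A) : gauge (D.fatten n) a ≤ (2 : ℝ) ^ n * ‖a‖ := by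
  have := mul_gauge_le_norm (x := a) (D.ball_subset_fatten n)
  rwa [inv_mul_le_iff₀ (by positivity)] at this

/-- The space `A` with the Minkowski functional of `2ⁿ W + 2⁻ⁿ B` as its norm. -/
@[nolint unusedArguments]
def Renorm (_ : BoundedDisk A) (_ : ℕ) : Type _ := A

instance (n : ℕ) : AddCommGroup (D.Renorm n) := inferInstanceAs (AddCommGroup A)

instance (n : ℕ) : Module ℝ (D.Renorm n) := inferInstanceAs (Module ℝ A)

/-- The identity map from `A` to its renorming. -/
def toRenorm (n : ℕ) : A ≃ₗ[ℝ] D.Renorm n := LinearEquiv.refl ℝ A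

instance (n : ℕ) : Norm (D.Renorm n) := ⟨fun a => gauge (D.fatten n) ((D.toRenorm n).symm a)⟩

theorem norm_toRenorm (n : ℕ) (a : A) : ‖D.toRenorm n a‖ = gauge (D.fatten n) a := rfl

theorem renorm_core (n : ℕ) : NormedSpace.Core ℝ (D.Renorm n) where
  norm_nonneg _ := gauge_nonneg _
  norm_smul c x := gauge_smul (D.balanced_fatten n) c ((D.toRenorm n).symm x)
  norm_triangle x y := gauge_add_le (D.convex_fatten n) (D.absorbent_fatten n)
    ((D.toRenorm n).symm x) ((D.toRenorm n).symm y)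
  norm_eq_zero_iff x := by
    obtain ⟨a, rfl⟩ := (D.toRenorm n).surjective x
    rw [norm_toRenorm, LinearEquiv.map_eq_zero_iff]
    refine ⟨fun h => ?_, fun h => by rw [h, gauge_zero]⟩
    have := D.norm_le_mul_gauge n a
    rw [h, mul_zero] at this
    exact norm_le_zero_iff.mp this

instance (n : ℕ) : NormedAddCommGroup (D.Renorm n) := NormedAddCommGroup.ofCore (D.renorm_core n)

instance (n : ℕ) : NormedSpace ℝ (D.Renorm n) := NormedSpace.ofCore (D.renorm_core n)

/-- The renormings are isomorphic to the original space. -/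
def renormEquiv (n : ℕ) : A ≃L[ℝ] D.Renorm n :=
  (D.toRenorm n).toContinuousLinearEquivOfBounds ((2 : ℝ) ^ n) (D.fattenRadius n)
    (fun a => D.gauge_le_mul_norm n a)
    (fun x => D.norm_le_mul_gauge n ((D.toRenorm n).symm x))

theorem norm_renormEquiv (n : ℕ) (a : A) : ‖D.renormEquiv n a‖ = gauge (D.fatten n) a := rfl

instance [CompleteSpace A] (n : ℕ) : CompleteSpace (D.Renorm n) :=
  (completeSpace_congr (e := (D.renormEquiv n).toEquiv) (D.renormEquiv n).isUniformEmbedding).1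
    inferInstance

instance [TopologicalSpace.SeparableSpace A] (n : ℕ) :
    TopologicalSpace.SeparableSpace (D.Renorm n) :=
  (D.renormEquiv n).surjective.denseRange.separableSpace (D.renormEquiv n).continuous

/-- The `ℓ²`-sum of the renormings. -/
abbrev Sum : Type _ := lp (fun n : ℕ => D.Renorm (n + 1)) 2

/-- The `n`-th coordinate, as an element of the original space. -/
def coord (n : ℕ) : D.Sum →L[ℝ] A :=
  ((D.renormEquiv (n + 1)).symm : D.Renorm (n + 1) →L[ℝ] A).comp
    (lp.evalCLM ℝ (fun n : ℕ => D.Renorm (n + 1)) 2 n)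

theorem coord_apply (n : ℕ) (z : D.Sum) : D.coord n z = (D.renormEquiv (n + 1)).symm (z n) := rfl

/-- The DFJP space of the disk, as the diagonal of the `ℓ²`-sum of the renormings. -/
def diagonal : Submodule ℝ D.Sum where
  carrier := {z | ∀ n, D.coord n z = D.coord 0 z}
  add_mem' h h' n := by rw [map_add, map_add, h n, h' n]
  zero_mem' n := by rw [map_zero, map_zero]
  smul_mem' c z h n := by rw [map_smul, map_smul, h n]

theorem isClosed_diagonal : IsClosed (D.diagonal : Set D.Sum) := by
  have : (D.diagonal : Set D.Sum) = ⋂ n, {z | D.coord n z = D.coord 0 z} := by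
    ext z
    simp only [Set.mem_iInter]
    rfl
  rw [this]
  exact isClosed_iInter fun n => isClosed_eq (D.coord n).continuous (D.coord 0).continuous

/-- The DFJP space of the disk. -/
def Space : Type _ := D.diagonal

instance : NormedAddCommGroup D.Space := inferInstanceAs (NormedAddCommGroup D.diagonal)

instance : NormedSpace ℝ D.Space := inferInstanceAs (NormedSpace ℝ D.diagonal)

instance [CompleteSpace A] : CompleteSpace D.Space := D.isClosed_diagonal.completeSpace_coe

instance [TopologicalSpace.SeparableSpace A] : TopologicalSpace.SeparableSpace D.Space :=
  have : TopologicalSpace.SeparableSpace D.Sum := lp_two_separableSpace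
  inferInstanceAs (TopologicalSpace.SeparableSpace D.diagonal)

/-- The inclusion of the DFJP space. -/
def incl : D.Space →L[ℝ] A := (D.coord 0).comp (D.diagonal.subtypeL : D.diagonal →L[ℝ] D.Sum)

theorem apply_eq_renormEquiv (v : D.Space) (n : ℕ) :
    v.1 n = D.renormEquiv (n + 1) (D.incl v) := by
  rw [← ContinuousLinearEquiv.symm_apply_eq]
  exact v.2 n

theorem incl_injective : Function.Injective D.incl := fun v v' h => by
  apply Subtype.ext
  apply lp.ext
  funext n
  rw [apply_eq_renormEquiv, apply_eq_renormEquiv, h]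

theorem gauge_incl_le (v : D.Space) (n : ℕ) : gauge (D.fatten (n + 1)) (D.incl v) ≤ ‖v‖ := by
  rw [← norm_renormEquiv, ← apply_eq_renormEquiv]
  exact lp.norm_apply_le_norm (by simp) v.1 n

theorem isDFJPInclusion : IsDFJPInclusion D.carrier D.incl where
  mem_range_iff a := by
    constructor
    · rintro ⟨v, rfl⟩
      have := (lp.memℓp v.1).summable (by simp)
      simp only [apply_eq_renormEquiv, norm_renormEquiv, ENNReal.toReal_ofNat, Real.rpow_two]
        at this
      exact this
    · intro h
      have hm : Memℓp (fun n : ℕ => D.renormEquiv (n + 1) a) 2 := by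
        refine memℓp_gen ?_
        simp only [norm_renormEquiv, ENNReal.toReal_ofNat, Real.rpow_two]
        exact h
      refine ⟨⟨⟨_, hm⟩, fun n => ?_⟩, ?_⟩
      · rw [coord_apply, coord_apply]
        exact ((D.renormEquiv (n + 1)).symm_apply_apply a).trans
          ((D.renormEquiv (0 + 1)).symm_apply_apply a).symm
      · exact (D.renormEquiv (0 + 1)).symm_apply_apply a
  norm_eq v := by
    have := lp.norm_eq_tsum_rpow (p := 2) (by simp) v.1
    simp only [apply_eq_renormEquiv, norm_renormEquiv, ENNReal.toReal_ofNat, Real.rpow_two]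
      at this
    rw [Real.sqrt_eq_rpow]
    exact this

/-- Functionals on the DFJP space are norm limits of functionals on the original space. -/
theorem exists_dual_abs_sub_le (φ : StrongDual ℝ D.Space) {ε : ℝ} (hε : 0 < ε) :
    ∃ μ : StrongDual ℝ A, ∀ v, |φ v - μ (D.incl v)| ≤ ε * ‖v‖ := by
  -- After extension to the whole `ℓ²`-sum, all but finitely many coordinates may be dropped; each
  -- remaining one is a functional on a renorming of `A`, hence on `A`.
  obtain ⟨Φ, hΦ, -⟩ := exists_extension_norm_eq D.diagonal φ
  obtain ⟨s, hs⟩ := exists_finset_abs_sub_sum_single_le Φ hε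
  refine ⟨∑ i ∈ s, Φ.comp ((lp.singleContinuousLinearMap ℝ (fun n : ℕ => D.Renorm (n + 1)) 2 i).comp
    (D.renormEquiv (i + 1) : A →L[ℝ] D.Renorm (i + 1))), fun v => ?_⟩
  have h := hs v.1
  rw [show Φ v.1 = φ v from hΦ v] at h
  refine le_of_eq_of_le (congrArg (fun t => |φ v - t|) ?_) h
  rw [sum_apply]
  refine Finset.sum_congr rfl fun i _ => ?_
  rw [apply_eq_renormEquiv]
  rfl

/-- Since the gauge of `v` is less than `2`, `v` is `r` times an element of `2ⁿ⁺¹ W + 2⁻⁽ⁿ⁺¹⁾ B`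
with `r < 2`. The ratio `r / 2` is absorbed into the disk. -/
theorem exists_norm_incl_sub_le (v : D.Space) (hv : ‖v‖ ≤ 1) (n : ℕ) :
    ∃ w ∈ D.carrier, ‖D.incl v - (2 * 2 ^ (n + 1) : ℝ) • w‖ ≤ 2 * ((2 : ℝ) ^ (n + 1))⁻¹ := by
  obtain ⟨r, hr0, hr2, a, ha, hav⟩ := exists_lt_of_gauge_lt (D.absorbent_fatten (n + 1))
    (((D.gauge_incl_le v n).trans hv).trans_lt one_lt_two)
  obtain ⟨w, hw, hwa⟩ := D.mem_fatten_iff.mp ha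
  refine ⟨(r / 2) • w, D.smul_mem (by positivity) (by linarith) hw, ?_⟩
  have : D.incl v - (2 * 2 ^ (n + 1) : ℝ) • (r / 2) • w = r • (a - (2 : ℝ) ^ (n + 1) • w) := by
    rw [← hav, smul_sub, smul_smul, smul_smul]
    congr 2
    ring
  rw [this, norm_smul, Real.norm_of_nonneg hr0.le]
  exact mul_le_mul hr2.le hwa (norm_nonneg _) zero_le_two

/-- Elements of the disk belong to the DFJP space. -/
theorem exists_incl_eq {w : A} (hw : w ∈ D.carrier) : ∃ v : D.Space, D.incl v = w ∧ ‖v‖ ≤ 1 := by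
  -- The element `2ⁿ⁺¹ w` lies in the fattened disk, so the gauge of `w` is at most `2⁻⁽ⁿ⁺¹⁾`. The
  -- weaker bound by the same number for the square already sums to exactly `1`.
  have hg (n : ℕ) : gauge (D.fatten (n + 1)) w ^ 2 ≤ (1 / 2) * (1 / 2) ^ n := by
    have h1 : gauge (D.fatten (n + 1)) w ≤ ((2 : ℝ) ^ (n + 1))⁻¹ := by
      refine gauge_le_of_mem (by positivity)
        ((Set.mem_inv_smul_set_iff₀ (by positivity) _ _).mpr ?_)
      exact D.mem_fatten_iff.mpr ⟨w, hw, by rw [sub_self, norm_zero]; positivity⟩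
    have h2 : ((2 : ℝ) ^ (n + 1))⁻¹ = (1 / 2) * (1 / 2) ^ n := by
      rw [← inv_pow, pow_succ']; norm_num
    have h3 : (1 / 2 : ℝ) * (1 / 2) ^ n ≤ 1 := by
      have := pow_le_one₀ (n := n) (show (0 : ℝ) ≤ 1 / 2 by norm_num) (by norm_num)
      linarith
    rw [h2] at h1
    have h0 : 0 ≤ gauge (D.fatten (n + 1)) w := gauge_nonneg _
    nlinarith
  have hsum : Summable fun n : ℕ => (1 / 2 : ℝ) * (1 / 2) ^ n :=
    (summable_geometric_two).mul_left _
  have hs : Summable fun n : ℕ => gauge (D.fatten (n + 1)) w ^ 2 :=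
    hsum.of_nonneg_of_le (fun _ => sq_nonneg _) hg
  obtain ⟨v, hv⟩ := (D.isDFJPInclusion.mem_range_iff w).mpr hs
  refine ⟨v, hv, ?_⟩
  rw [D.isDFJPInclusion.norm_eq v, hv, Real.sqrt_le_iff, one_pow]
  refine ⟨zero_le_one, ?_⟩
  refine (hs.tsum_le_tsum hg hsum).trans_eq ?_
  rw [tsum_mul_left, tsum_geometric_two]
  norm_num

variable {D}

theorem apply_mem_fatten (T : A ≃ₗᵢ[ℝ] A) (hT : ∀ a ∈ D.carrier, T a ∈ D.carrier) {n : ℕ} {a : A}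
    (ha : a ∈ D.fatten n) : T a ∈ D.fatten n := by
  rw [mem_fatten_iff] at ha ⊢
  obtain ⟨w, hw, h⟩ := ha
  refine ⟨T w, hT w hw, ?_⟩
  rwa [← map_smul, ← map_sub, T.norm_map]

theorem gauge_apply (T : A ≃ₗᵢ[ℝ] A) (hT : ∀ a ∈ D.carrier, T a ∈ D.carrier)
    (hT' : ∀ a ∈ D.carrier, T.symm a ∈ D.carrier) (n : ℕ) (a : A) :
    gauge (D.fatten n) (T a) = gauge (D.fatten n) a := by
  rw [gauge_def', gauge_def']
  congr 1
  ext r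
  refine and_congr_right fun _ => ?_
  rw [← map_smul]
  refine ⟨fun h => ?_, apply_mem_fatten T hT⟩
  have := apply_mem_fatten T.symm hT' h
  rwa [T.symm_apply_apply] at this

theorem apply_mem_range_incl (T : A ≃ₗᵢ[ℝ] A) (hT : ∀ a ∈ D.carrier, T a ∈ D.carrier)
    (hT' : ∀ a ∈ D.carrier, T.symm a ∈ D.carrier) (a : A) :
    T a ∈ Set.range D.incl ↔ a ∈ Set.range D.incl := by
  rw [D.isDFJPInclusion.mem_range_iff, D.isDFJPInclusion.mem_range_iff]
  exact summable_congr fun n => by rw [← fatten, gauge_apply T hT hT']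

/-- A linear isometry preserving the disk induces an isometry of the DFJP space. -/
theorem exists_linearIsometryEquiv (T : A ≃ₗᵢ[ℝ] A) (hT : ∀ a ∈ D.carrier, T a ∈ D.carrier)
    (hT' : ∀ a ∈ D.carrier, T.symm a ∈ D.carrier) :
    ∃ S : D.Space ≃ₗᵢ[ℝ] D.Space, ∀ v, D.incl (S v) = T (D.incl v) := by
  let e := LinearEquiv.ofInjective (D.incl : D.Space →ₗ[ℝ] A) D.incl_injective
  have hmap : (LinearMap.range (D.incl : D.Space →ₗ[ℝ] A)).map
      (T.toLinearEquiv : A →ₗ[ℝ] A) = LinearMap.range (D.incl : D.Space →ₗ[ℝ] A) := by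
    ext a
    constructor
    · rintro ⟨b, hb, rfl⟩
      exact (apply_mem_range_incl T hT hT' b).mpr hb
    · intro ha
      refine ⟨T.symm a, (apply_mem_range_incl T hT hT' _).mp ?_, T.apply_symm_apply a⟩
      rw [T.apply_symm_apply]
      exact ha
  let S₀ : D.Space ≃ₗ[ℝ] D.Space := e.trans ((T.toLinearEquiv.ofSubmodules _ _ hmap).trans e.symm)
  have hS (v : D.Space) : D.incl (S₀ v) = T (D.incl v) :=
    congrArg Subtype.val (e.apply_symm_apply (T.toLinearEquiv.ofSubmodules _ _ hmap (e v)))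
  refine ⟨⟨S₀, fun v => ?_⟩, hS⟩
  rw [D.isDFJPInclusion.norm_eq, D.isDFJPInclusion.norm_eq, hS]
  congr 1
  exact tsum_congr fun n => by rw [← fatten, gauge_apply T hT hT']

end BoundedDisk

end

noncomputable section

open Filter Topology MeasureTheory

/-! ### Functionals on spaces of continuous functions -/

section Domination

variable {X : Type*} [TopologicalSpace X]

open scoped NNReal CompactlySupported

/-- The values of a functional on the functions dominated by `f`. -/
def dominatedValues (μ : StrongDual ℝ C(X, ℝ)) (f : C_c(X, ℝ≥0)) : Set ℝ :=
  {t | ∃ g : C(X, ℝ), (∀ x, |g x| ≤ f x) ∧ μ g = t}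

theorem zero_mem_dominatedValues (μ : StrongDual ℝ C(X, ℝ)) (f : C_c(X, ℝ≥0)) :
    0 ∈ dominatedValues μ f := ⟨0, fun x => by simp, map_zero μ⟩

theorem bddAbove_dominatedValues [CompactSpace X] (μ : StrongDual ℝ C(X, ℝ)) (f : C_c(X, ℝ≥0)) :
    BddAbove (dominatedValues μ f) := by
  obtain ⟨C, hC⟩ := (isCompact_range f.continuous).bddAbove
  refine ⟨‖μ‖ * C, ?_⟩
  rintro _ ⟨g, hg, rfl⟩
  refine (le_abs_self _).trans ((μ.le_opNorm g).trans ?_)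
  refine mul_le_mul_of_nonneg_left ((ContinuousMap.norm_le _ C.2).mpr fun x => ?_) (norm_nonneg _)
  exact (hg x).trans (by exact_mod_cast hC ⟨x, rfl⟩)

/-- This is the Riesz decomposition property: truncating `g` to the interval from `-f` to `f` leaves
a remainder dominated by `f'`. Additivity of the total variation follows. -/
theorem dominatedValues_add (μ : StrongDual ℝ C(X, ℝ)) (f f' : C_c(X, ℝ≥0)) :
    dominatedValues μ (f + f') = dominatedValues μ f + dominatedValues μ f' := by
  ext t
  constructor
  · rintro ⟨g, hg, rfl⟩
    let F : C(X, ℝ) := ⟨fun x => f x, by fun_prop⟩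
    let g₁ : C(X, ℝ) := (g ⊓ F) ⊔ (-F)
    refine ⟨μ g₁, ⟨g₁, fun x => ?_, rfl⟩, μ (g - g₁), ⟨g - g₁, fun x => ?_, rfl⟩, ?_⟩
    · change |max (min (g x) (f x : ℝ)) (-(f x : ℝ))| ≤ _
      have h0 : (0 : ℝ) ≤ f x := (f x).2
      rw [abs_le]
      exact ⟨le_max_right _ _, max_le (min_le_right _ _) (by linarith)⟩
    · change |g x - max (min (g x) (f x : ℝ)) (-(f x : ℝ))| ≤ _
      have h0 : (0 : ℝ) ≤ f x := (f x).2
      have h0' : (0 : ℝ) ≤ f' x := (f' x).2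
      have h := abs_le.mp (hg x)
      rw [CompactlySupportedContinuousMap.add_apply, NNReal.coe_add] at h
      rw [abs_le]
      rcases le_total (g x) (f x) with h1 | h1
      · rw [min_eq_left h1]
        rcases le_total (g x) (-(f x : ℝ)) with h2 | h2
        · rw [max_eq_right h2]; constructor <;> linarith
        · rw [max_eq_left h2]; constructor <;> linarith
      · rw [min_eq_right h1, max_eq_left (by linarith)]; constructor <;> linarith
    · simp
  · rintro ⟨_, ⟨g, hg, rfl⟩, _, ⟨g', hg', rfl⟩, rfl⟩
    refine ⟨g + g', fun x => ?_, map_add μ g g'⟩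
    rw [CompactlySupportedContinuousMap.add_apply, NNReal.coe_add]
    exact (abs_add_le _ _).trans (add_le_add (hg x) (hg' x))

theorem dominatedValues_smul (μ : StrongDual ℝ C(X, ℝ)) (r : ℝ≥0) (f : C_c(X, ℝ≥0)) :
    dominatedValues μ (r • f) = (r : ℝ) • dominatedValues μ f := by
  ext t
  constructor
  · rintro ⟨g, hg, rfl⟩
    have hg' (x : X) : |g x| ≤ r * f x := by simpa using hg x
    rcases eq_or_ne r 0 with rfl | hr
    · refine ⟨0, zero_mem_dominatedValues μ f, ?_⟩
      have : g = 0 := by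
        ext x
        have := hg' x
        rw [NNReal.coe_zero, zero_mul] at this
        exact abs_nonpos_iff.mp this
      simp [this]
    · have hr' : (0 : ℝ) < r := by positivity
      refine ⟨(r : ℝ)⁻¹ • μ g, ⟨(r : ℝ)⁻¹ • g, fun x => ?_, map_smul μ _ _⟩, ?_⟩
      · rw [ContinuousMap.smul_apply, smul_eq_mul, abs_mul, abs_inv, abs_of_pos hr',
          inv_mul_le_iff₀ hr']
        exact hg' x
      · exact smul_inv_smul₀ hr'.ne' _
  · rintro ⟨_, ⟨g, hg, rfl⟩, rfl⟩
    refine ⟨(r : ℝ) • g, fun x => ?_, map_smul μ _ _⟩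
    rw [ContinuousMap.smul_apply, smul_eq_mul, abs_mul, abs_of_nonneg r.coe_nonneg,
      CompactlySupportedContinuousMap.smul_apply, smul_eq_mul, NNReal.coe_mul]
    exact mul_le_mul_of_nonneg_left (hg x) r.2

/-- The total variation of a functional, on nonnegative functions. -/
def totalVariation [CompactSpace X] (μ : StrongDual ℝ C(X, ℝ)) : C_c(X, ℝ≥0) →ₗ[ℝ≥0] ℝ≥0 where
  toFun f := ⟨sSup (dominatedValues μ f),
    le_csSup (bddAbove_dominatedValues μ f) (zero_mem_dominatedValues μ f)⟩
  map_add' f f' := NNReal.eq (by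
    change sSup _ = sSup _ + sSup _
    rw [dominatedValues_add, csSup_add ⟨0, zero_mem_dominatedValues μ f⟩
      (bddAbove_dominatedValues μ f) ⟨0, zero_mem_dominatedValues μ f'⟩
      (bddAbove_dominatedValues μ f')])
  map_smul' r f := NNReal.eq (by
    change sSup _ = (r : ℝ) * sSup _
    rw [dominatedValues_smul, Real.sSup_smul_of_nonneg r.coe_nonneg, smul_eq_mul])

/-- Every functional on `C(X)` is dominated by a finite measure. -/
theorem exists_measure_abs_le_integral [CompactSpace X] [T2Space X] [MeasurableSpace X]
    [BorelSpace X] (μ : StrongDual ℝ C(X, ℝ)) :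
    ∃ m : Measure X, IsFiniteMeasure m ∧ ∀ f : C(X, ℝ), |μ f| ≤ ∫ x, |f x| ∂m := by
  -- The measure is the Riesz–Markov–Kakutani representation of the total variation.
  let Λ := CompactlySupportedContinuousMap.toRealPositiveLinear (totalVariation μ)
  refine ⟨RealRMK.rieszMeasure Λ, inferInstance, fun f => ?_⟩
  let F : C_c(X, ℝ≥0) := ⟨⟨fun x => ‖f x‖₊, by fun_prop⟩, HasCompactSupport.of_compactSpace _⟩
  have h1 : ∫ x, |f x| ∂(RealRMK.rieszMeasure Λ) = totalVariation μ F := by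
    rw [← CompactlySupportedContinuousMap.eq_toRealPositiveLinear_toReal,
      ← RealRMK.integral_rieszMeasure]
    refine integral_congr_ae (ae_of_all _ fun x => ?_)
    rw [CompactlySupportedContinuousMap.toReal_apply]
    rfl
  rw [h1]
  have h2 (g : C(X, ℝ)) (hg : ∀ x, |g x| ≤ F x) : μ g ≤ totalVariation μ F :=
    le_csSup (bddAbove_dominatedValues μ F) ⟨g, hg, rfl⟩
  refine abs_le'.mpr ⟨h2 f fun x => le_rfl, ?_⟩
  rw [← map_neg]
  refine h2 (-f) fun x => ?_
  rw [ContinuousMap.neg_apply, abs_neg]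
  exact le_rfl

/-- Bounded pointwise Cauchy sequences in `C(X)` are weakly Cauchy. -/
theorem cauchySeq_dual_of_pointwise [CompactSpace X] [T2Space X] (μ : StrongDual ℝ C(X, ℝ))
    (u : ℕ → C(X, ℝ)) (C : ℝ) (hC : ∀ k, ‖u k‖ ≤ C) (hu : ∀ x, CauchySeq fun k => u k x) :
    CauchySeq fun k => μ (u k) := by
  let _ : MeasurableSpace X := borel X
  have : BorelSpace X := ⟨rfl⟩
  obtain ⟨m, hm, hμ⟩ := exists_measure_abs_le_integral μ
  -- The limit `L` is only measurable, so `μ` cannot be applied to it. Convergence to `L` in `L¹` of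
  -- the dominating measure is enough.
  choose L hL using fun x => cauchySeq_tendsto_of_complete (hu x)
  have hmeas : Measurable L := measurable_of_tendsto_metrizable
    (fun k => (u k).continuous.measurable) (tendsto_pi_nhds.mpr hL)
  have hle (k : ℕ) (x : X) : |u k x| ≤ C := ((u k).norm_coe_le_norm x).trans (hC k)
  have hLle (x : X) : |L x| ≤ C := le_of_tendsto (hL x).abs (Eventually.of_forall fun k => hle k x)
  have hint (k : ℕ) : Integrable (fun x => |u k x - L x|) m := by
    refine Integrable.of_bound (C := 2 * C) ?_ (ae_of_all _ fun x => ?_)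
    · exact ((u k).continuous.measurable.sub hmeas).abs.aestronglyMeasurable
    · rw [Real.norm_eq_abs, abs_abs]
      exact (abs_sub _ _).trans (by linarith [hle k x, hLle x])
  have hlim : Tendsto (fun k => ∫ x, |u k x - L x| ∂m) atTop (𝓝 0) := by
    have := tendsto_integral_of_dominated_convergence (μ := m) (F := fun k x => |u k x - L x|)
      (f := fun _ => 0) (fun _ => 2 * C) (fun k => (hint k).aestronglyMeasurable)
      (integrable_const _) (fun k => ae_of_all _ fun x => by
        rw [Real.norm_eq_abs, abs_abs]
        exact (abs_sub _ _).trans (by linarith [hle k x, hLle x]))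
      (ae_of_all _ fun x => by
        have := ((hL x).sub_const (L x)).abs
        rwa [sub_self, abs_zero] at this)
    simpa using this
  rw [Metric.cauchySeq_iff]
  intro ε hε
  obtain ⟨N, hN⟩ := eventually_atTop.mp (hlim.eventually_lt_const (half_pos hε))
  refine ⟨N, fun k hk l hl => ?_⟩
  rw [Real.dist_eq, ← map_sub]
  calc |μ (u k - u l)| ≤ ∫ x, |(u k - u l) x| ∂m := hμ _
    _ ≤ ∫ x, (|u k x - L x| + |u l x - L x|) ∂m := by
        refine integral_mono_of_nonneg (ae_of_all _ fun x => abs_nonneg _)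
          ((hint k).add (hint l)) (ae_of_all _ fun x => ?_)
        have := abs_sub (u k x - L x) (u l x - L x)
        rwa [sub_sub_sub_cancel_right] at this
    _ = (∫ x, |u k x - L x| ∂m) + ∫ x, |u l x - L x| ∂m := integral_add (hint k) (hint l)
    _ < ε := by linarith [hN k hk, hN l hl]

end Domination

end

noncomputable section

open Filter Topology MeasureTheory

/-! ### Dynamics of the boundary subshift -/

namespace BoundarySubshift

variable (P : TopologicalSpace.Clopens Boundary)

instance : T2Space (BoundarySubshift P) :=
  inferInstanceAs (T2Space {x : F2 → Bool // x ∈ Set.range (nameMap P)})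

instance : SecondCountableTopology (BoundarySubshift P) :=
  inferInstanceAs (SecondCountableTopology {x : F2 → Bool // x ∈ Set.range (nameMap P)})

/-- The name map, as a map onto the subshift. -/
def factor (ω : Boundary) : BoundarySubshift P := ⟨nameMap P ω, ω, rfl⟩

theorem factor_surjective : Function.Surjective (factor P) := by
  rintro ⟨_, ω, rfl⟩
  exact ⟨ω, rfl⟩

theorem continuous_factor : Continuous (factor P) :=
  continuous_induced_rng.mpr (continuous_nameMap P)

theorem smul_factor (g : F2) (ω : Boundary) : g • factor P ω = factor P (g • ω) := by
  apply Subtype.ext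
  funext h
  change nameMap P ω (h * g) = nameMap P (g • ω) h
  simp [nameMap, mul_smul]

instance : MulAction.IsMinimal F2 (BoundarySubshift P) where
  dense_orbit x := by
    obtain ⟨ω, rfl⟩ := factor_surjective P x
    refine ((factor_surjective P).denseRange.dense_image (continuous_factor P)
      (MulAction.dense_orbit F2 ω)).mono ?_
    rintro _ ⟨_, ⟨g, rfl⟩, rfl⟩
    exact ⟨g, smul_factor P g ω⟩

/-- The image of the infinite word `s s s ⋯`. -/
def pole (s : Letter) : BoundarySubshift P := factor P (Boundary.power s)

theorem of_smul_pole (i : Fin 2) (b : Bool) :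
    (FreeGroup.of i : F2) • pole P (i, b) = pole P (i, b) := by
  rw [pole, smul_factor, Boundary.of_smul_power]

theorem of_pow_smul_pole (i : Fin 2) (b : Bool) (n : ℕ) :
    (FreeGroup.of i ^ n : F2) • pole P (i, b) = pole P (i, b) := by
  induction n with
  | zero => rw [pow_zero, one_smul]
  | succ n ih => rw [pow_succ, mul_smul, of_smul_pole, ih]

theorem tendsto_of_pow_smul (i : Fin 2) {x : BoundarySubshift P} (hx : x ≠ pole P (i, false)) :
    Tendsto (fun n : ℕ => (FreeGroup.of i ^ n : F2) • x) atTop (𝓝 (pole P (i, true))) := by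
  obtain ⟨ω, rfl⟩ := factor_surjective P x
  have hω : ω ≠ Boundary.power (i, false) := fun h => hx (by rw [h]; rfl)
  simp only [smul_factor]
  exact ((continuous_factor P).tendsto _).comp (Boundary.tendsto_of_pow_smul i hω)

variable {P}

theorem exists_apply_one_ne (h0 : P ≠ ⊥) (h1 : P ≠ ⊤) :
    ∃ x y : BoundarySubshift P, x.1 1 = true ∧ y.1 1 = false := by
  obtain ⟨ω, hω⟩ : ∃ ω, ω ∈ P := by
    by_contra! h
    exact h0 (TopologicalSpace.Clopens.ext (Set.eq_empty_of_forall_notMem h))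
  obtain ⟨η, hη⟩ : ∃ η, η ∉ P := by
    by_contra! h
    exact h1 (TopologicalSpace.Clopens.ext (Set.eq_univ_of_forall h))
  refine ⟨factor P ω, factor P η, ?_, ?_⟩
  · change nameMap P ω 1 = true
    simpa [nameMap] using hω
  · change nameMap P η 1 = false
    simpa [nameMap] using hη

/-- In a finite, hence discrete, subshift, convergence of `aⁿ x` to a fixed pole is eventual
equality, so `x` is that pole. Every generator then acts trivially, and minimality leaves a single
point, against the two symbols that occur. -/
theorem infinite_of_ne (h0 : P ≠ ⊥) (h1 : P ≠ ⊤) : Infinite (BoundarySubshift P) := by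
  by_contra hfin
  have : Finite (BoundarySubshift P) := not_infinite_iff_finite.mp hfin
  have hgen (i : Fin 2) (x : BoundarySubshift P) : (FreeGroup.of i : F2) • x = x := by
    by_cases hx : x = pole P (i, false)
    · rw [hx, of_smul_pole]
    · have h := tendsto_of_pow_smul P i hx
      rw [nhds_discrete, tendsto_pure] at h
      obtain ⟨n, hn⟩ := h.exists
      rw [← of_pow_smul_pole P i true n] at hn
      rw [MulAction.injective _ hn, of_smul_pole]
  have htriv (g : F2) (x : BoundarySubshift P) : g • x = x := by
    induction g using FreeGroup.induction_on with
    | C1 => exact one_smul _ x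
    | of i => exact hgen i x
    | inv_of i _ => rw [inv_smul_eq_iff]; exact (hgen i x).symm
    | mul g h hg hh => rw [mul_smul, hh, hg]
  obtain ⟨x, y, hx, hy⟩ := exists_apply_one_ne h0 h1
  have hd := MulAction.dense_orbit F2 x
  obtain ⟨z, hz, g, hg⟩ := hd.inter_open_nonempty {y} (isOpen_discrete _) ⟨y, rfl⟩
  have : x = y := by
    rw [← (show z = y from hz), ← hg]
    exact (htriv g x).symm
  rw [this, hy] at hx
  exact Bool.false_ne_true hx

theorem infinite_orbit (h0 : P ≠ ⊥) (h1 : P ≠ ⊤) (x : BoundarySubshift P) :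
    (MulAction.orbit F2 x).Infinite := by
  intro hfin
  have := infinite_of_ne h0 h1
  have h := (MulAction.dense_orbit F2 x).closure_eq
  rw [hfin.isClosed.closure_eq] at h
  rw [h] at hfin
  exact Set.infinite_univ hfin

/-- Every finite measure is contracted to a point mass along some net in the group. -/
theorem exists_contracting (h0 : P ≠ ⊥) (h1 : P ≠ ⊤) (m : Measure (BoundarySubshift P))
    [IsFiniteMeasure m] :
    ∃ l : Filter F2, l.NeBot ∧ ∀ u : C(BoundarySubshift P, ℝ),
      Tendsto (fun g => ∫ x, |u (g • x) - u (pole P (0, true))| ∂m) l (𝓝 0) := by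
  set z := pole P (0, true) with hz
  set x₀ := pole P (0, false) with hx₀
  let I : F2 → C(BoundarySubshift P, ℝ) → ℝ := fun g u => ∫ x, |u (g • x) - u z| ∂m
  -- Acting by `h⁻¹` sends `h • x₀` to the repelling pole `x₀`, and powers of the generator then
  -- push every other point to `z`. By dominated convergence only the atom at `h • x₀` remains in
  -- the limit.
  have hJ (h : F2) : (fun u : C(BoundarySubshift P, ℝ) => |u x₀ - u z| * m.real {h • x₀}) ∈
      closure (Set.range I) := by
    refine mem_closure_of_tendsto (f := fun n : ℕ => I (FreeGroup.of 0 ^ n * h⁻¹)) (b := atTop) ?_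
      (Eventually.of_forall fun n => ⟨_, rfl⟩)
    refine tendsto_pi_nhds.mpr fun u => ?_
    have hlim : ∫ x, Set.indicator {h • x₀} (fun _ => |u x₀ - u z|) x ∂m =
        |u x₀ - u z| * m.real {h • x₀} := by
      rw [integral_indicator_const _ (measurableSet_singleton _), smul_eq_mul, mul_comm]
    rw [← hlim]
    refine tendsto_integral_of_dominated_convergence (fun _ => 2 * ‖u‖) (fun n => ?_)
      (integrable_const _) (fun n => ae_of_all _ fun x => ?_) (ae_of_all _ fun x => ?_)
    · exact (((u.continuous.comp (continuous_const_smul _)).sub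
        continuous_const).abs).aestronglyMeasurable
    · rw [Real.norm_eq_abs, abs_abs]
      refine (abs_sub _ _).trans ?_
      have e1 := u.norm_coe_le_norm ((FreeGroup.of 0 ^ n * h⁻¹ : F2) • x)
      have e2 := u.norm_coe_le_norm z
      rw [Real.norm_eq_abs] at e1 e2
      linarith
    · by_cases hx : x = h • x₀
      · subst hx
        rw [Set.indicator_of_mem (Set.mem_singleton _)]
        simp only [mul_smul, inv_smul_smul, hx₀, of_pow_smul_pole]
        exact tendsto_const_nhds
      · rw [Set.indicator_of_notMem (by simpa using hx)]
        have hne : h⁻¹ • x ≠ x₀ := fun e => hx (by rw [← e, smul_inv_smul])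
        have := ((u.continuous.tendsto z).comp (tendsto_of_pow_smul P 0 hne)).sub_const (u z)
        rw [sub_self] at this
        have := this.abs
        rw [abs_zero] at this
        simpa only [mul_smul, Function.comp_apply] using this
  have hinf := infinite_orbit h0 h1 x₀
  obtain ⟨y⟩ : Nonempty (ℕ ↪ MulAction.orbit F2 x₀) := ⟨hinf.natEmbedding⟩
  choose h hh using fun k => (y k).2
  have hinj : Function.Injective fun k => h k • x₀ := fun k k' e =>
    y.injective (Subtype.ext ((hh k).symm.trans (e.trans (hh k'))))
  -- The atoms at infinitely many distinct points of the orbit have finite total mass, so they tend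
  -- to zero. Hence `0` is a limit of limits of values of `I`, and so lies in the closure of its
  -- range.
  have hsum : Summable fun k => m.real {h k • x₀} := by
    refine ENNReal.summable_toReal (ne_top_of_le_ne_top (measure_ne_top m Set.univ) ?_)
    refine (tsum_meas_le_meas_iUnion_of_disjoint m (fun k => measurableSet_singleton _) ?_).trans
      (measure_mono (Set.subset_univ _))
    intro k k' hne
    exact Set.disjoint_singleton.mpr fun e => hne (hinj e)
  have hzero : (0 : C(BoundarySubshift P, ℝ) → ℝ) ∈ closure (Set.range I) := by
    rw [← closure_closure]
    refine mem_closure_of_tendsto (f := fun (k : ℕ) (u : C(BoundarySubshift P, ℝ)) =>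
      |u x₀ - u z| * m.real {h k • x₀}) (b := atTop) ?_ (Eventually.of_forall fun k => hJ (h k))
    refine tendsto_pi_nhds.mpr fun u => ?_
    have := hsum.tendsto_atTop_zero.const_mul |u x₀ - u z|
    rwa [mul_zero] at this
  refine ⟨comap I (𝓝 0), ?_, fun u => ?_⟩
  · rw [comap_neBot_iff_frequently]
    exact mem_closure_iff_frequently.mp hzero
  · exact (tendsto_pi_nhds.mp (tendsto_comap (f := I) (x := 𝓝 0))) u

/-- The sum `μ + ν` dominates both measures, so a net contracting it to the point mass at `z`
contracts both. -/
theorem isStronglyProximal (h0 : P ≠ ⊥) (h1 : P ≠ ⊤) :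
    IsStronglyProximal F2 (BoundarySubshift P) := by
  intro μ ν
  obtain ⟨l, hl, h⟩ := exists_contracting h0 h1
    ((μ : Measure (BoundarySubshift P)) + (ν : Measure (BoundarySubshift P)))
  set z := pole P (0, true) with hz
  have key (κ : ProbabilityMeasure (BoundarySubshift P))
      (hκ : (κ : Measure (BoundarySubshift P)) ≤
        (μ : Measure (BoundarySubshift P)) + (ν : Measure (BoundarySubshift P))) :
      Tendsto (fun g : F2 => κ.map (f := fun x : BoundarySubshift P => g • x)
        (continuous_const_smul g).measurable.aemeasurable) l (𝓝 (diracProba z)) := by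
    rw [ProbabilityMeasure.tendsto_iff_forall_integral_tendsto]
    intro u
    rw [show ((diracProba z : ProbabilityMeasure _) : Measure (BoundarySubshift P)) =
      Measure.dirac z from rfl, integral_dirac, tendsto_iff_norm_sub_tendsto_zero]
    refine squeeze_zero (fun _ => norm_nonneg _) (fun g => ?_) (h u.toContinuousMap)
    have hint (ρ : Measure (BoundarySubshift P)) [IsFiniteMeasure ρ] :
        Integrable (fun x => u (g • x)) ρ :=
      Integrable.of_bound (C := ‖u‖)
        (u.continuous.comp (continuous_const_smul g)).aestronglyMeasurable
        (ae_of_all _ fun x => u.norm_coe_le_norm _)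
    have e : ∫ x, u x ∂((κ.map (f := fun x : BoundarySubshift P => g • x)
        (continuous_const_smul g).measurable.aemeasurable : ProbabilityMeasure _) :
          Measure (BoundarySubshift P)) - u z = ∫ x, (u (g • x) - u z) ∂κ := by
      rw [integral_sub (hint _) (integrable_const _), integral_const, probReal_univ, one_smul,
        ProbabilityMeasure.toMeasure_map, integral_map
          (continuous_const_smul g).measurable.aemeasurable u.continuous.aestronglyMeasurable]
    rw [e]
    refine (norm_integral_le_integral_norm _).trans ?_
    exact integral_mono_measure hκ (ae_of_all _ fun x => norm_nonneg _)
      ((hint _).sub (integrable_const _)).norm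
  exact ⟨_, l, hl, key μ (Measure.le_add_right le_rfl), key ν (Measure.le_add_left le_rfl)⟩

end BoundarySubshift

end

noncomputable section

open Filter Topology MeasureTheory

/-! ### The representation on the DFJP space of an orbit -/

theorem dualAct_apply {G X V : Type*} [Group G] [TopologicalSpace X] [MulAction G X]
    [NormedAddCommGroup V] [NormedSpace ℝ V] (R : BanachRepresentation G X V) (g : G)
    (φ : StrongDual ℝ V) (v : V) : R.dualAct g φ v = φ (R.h g v) := rfl

section OrbitDisk

variable (G : Type*) {X : Type*} [Group G] [TopologicalSpace X] [CompactSpace X] [MulAction G X]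
  [ContinuousConstSMul G X]

variable {G} in
/-- The translation `u ↦ u ∘ g` of continuous functions. -/
def smulComp (g : G) : C(X, ℝ) ≃ₗᵢ[ℝ] C(X, ℝ) where
  toFun u := u.comp ⟨fun x => g • x, continuous_const_smul g⟩
  invFun u := u.comp ⟨fun x => g⁻¹ • x, continuous_const_smul g⁻¹⟩
  map_add' _ _ := rfl
  map_smul' _ _ := rfl
  left_inv u := by ext x; simp
  right_inv u := by ext x; simp
  norm_map' u := by
    refine le_antisymm ((ContinuousMap.norm_le _ (norm_nonneg _)).mpr fun x =>
      u.norm_coe_le_norm _) ((ContinuousMap.norm_le _ (norm_nonneg _)).mpr fun x => ?_)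
    have := (u.comp ⟨fun x => g • x, continuous_const_smul g⟩).norm_coe_le_norm (g⁻¹ • x)
    simpa using this

variable {G}

theorem smulComp_apply (g : G) (u : C(X, ℝ)) (x : X) : smulComp g u x = u (g • x) := rfl

theorem smulComp_symm_apply (g : G) (u : C(X, ℝ)) :
    (smulComp g : C(X, ℝ) ≃ₗᵢ[ℝ] C(X, ℝ)).symm u = smulComp g⁻¹ u := by
  rw [LinearIsometryEquiv.symm_apply_eq]
  ext x
  simp only [smulComp_apply, inv_smul_smul]

theorem smulComp_mul (g g' : G) (u : C(X, ℝ)) :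
    smulComp (g * g') u = smulComp g' (smulComp g u) := by
  ext x
  simp only [smulComp_apply, mul_smul]

theorem orbitHull_eq (f : C(X, ℝ)) : orbitHull G f = convexHull ℝ
    (closure (Set.range fun g : G => smulComp g f) ∪
      -closure (Set.range fun g : G => smulComp g f)) := rfl

/-- A closed convex symmetric set containing the orbit of `f` contains its hull. -/
theorem orbitHull_subset {f : C(X, ℝ)} {S : Set C(X, ℝ)} (hc : Convex ℝ S) (hcl : IsClosed S)
    (hneg : ∀ u ∈ S, -u ∈ S) (hf : ∀ g : G, smulComp g f ∈ S) : orbitHull G f ⊆ S := by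
  rw [orbitHull_eq]
  have h : closure (Set.range fun g : G => smulComp g f) ⊆ S :=
    closure_minimal (Set.range_subset_iff.mpr hf) hcl
  refine convexHull_min (Set.union_subset h fun u hu => ?_) hc
  have := hneg _ (h hu)
  rwa [neg_neg] at this

theorem self_mem_orbitHull (f : C(X, ℝ)) : f ∈ orbitHull G f := by
  refine subset_convexHull ℝ _ (Or.inl (subset_closure ⟨1, ?_⟩))
  ext x
  change f ((1 : G) • x) = f x
  rw [one_smul]

theorem neg_mem_orbitHull {f u : C(X, ℝ)} (hu : u ∈ orbitHull G f) : -u ∈ orbitHull G f := by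
  rw [orbitHull_eq] at hu ⊢
  rw [← Set.mem_neg, ← convexHull_neg, Set.union_neg, neg_neg, Set.union_comm]
  exact hu

theorem smulComp_mem_orbitHull (g : G) {f u : C(X, ℝ)} (hu : u ∈ orbitHull G f) :
    smulComp g u ∈ orbitHull G f := by
  have hF : ∀ u ∈ closure (Set.range fun g : G => smulComp g f),
      smulComp g u ∈ closure (Set.range fun g : G => smulComp g f) := fun u hu =>
    map_mem_closure (smulComp g).continuous hu (by
      rintro _ ⟨g', rfl⟩
      exact ⟨g' * g, smulComp_mul g' g f⟩)
  rw [orbitHull_eq] at hu ⊢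
  refine convexHull_min (t := smulComp g ⁻¹' _) ?_
    ((convex_convexHull ℝ _).linear_preimage (smulComp g).toLinearEquiv.toLinearMap) hu
  clear hu u
  rintro u (hu | hu)
  · exact subset_convexHull ℝ _ (Or.inl (hF u hu))
  · refine subset_convexHull ℝ _ (Or.inr ?_)
    have := hF _ hu
    rwa [map_neg] at this

variable (G) in
/-- The disk generated by the orbit of a continuous function. -/
def orbitDisk (f : C(X, ℝ)) : BoundedDisk C(X, ℝ) where
  carrier := orbitHull G f
  convex := convex_convexHull ℝ _
  neg_mem _ := neg_mem_orbitHull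
  radius := ‖f‖
  norm_le u hu := by
    rw [← mem_closedBall_zero_iff]
    refine orbitHull_subset (convex_closedBall _ _) Metric.isClosed_closedBall (fun u hu => ?_)
      (fun g => ?_) hu
    · rwa [mem_closedBall_zero_iff, norm_neg, ← mem_closedBall_zero_iff]
    · rw [mem_closedBall_zero_iff, LinearIsometryEquiv.norm_map]
  nonempty := ⟨f, self_mem_orbitHull f⟩

theorem exists_isometry_orbitDisk (f : C(X, ℝ)) (g : G) :
    ∃ S : (orbitDisk G f).Space ≃ₗᵢ[ℝ] (orbitDisk G f).Space,
      ∀ v, (orbitDisk G f).incl (S v) = smulComp g ((orbitDisk G f).incl v) :=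
  BoundedDisk.exists_linearIsometryEquiv (D := orbitDisk G f) (smulComp g)
    (fun _ => smulComp_mem_orbitHull g)
    (fun u hu => by rw [smulComp_symm_apply]; exact smulComp_mem_orbitHull g⁻¹ hu)

variable (G) in
/-- The evaluation at a point, on the DFJP space. -/
def evalFunctional (f : C(X, ℝ)) (x : X) : StrongDual ℝ (orbitDisk G f).Space :=
  (ContinuousMap.evalCLM ℝ x).comp (orbitDisk G f).incl

theorem evalFunctional_apply (f : C(X, ℝ)) (x : X) (v : (orbitDisk G f).Space) :
    evalFunctional G f x v = (orbitDisk G f).incl v x := rfl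

variable (G) in
/-- The representation of `(X, G)` on the DFJP space of the orbit of `f`. -/
def orbitRepresentation (f : C(X, ℝ)) :
    BanachRepresentation G X (orbitDisk G f).Space where
  h g := (exists_isometry_orbitDisk f g).choose
  h_mul g g' := by
    ext1 v
    apply (orbitDisk G f).incl_injective
    change _ = (orbitDisk G f).incl ((exists_isometry_orbitDisk f g').choose
      ((exists_isometry_orbitDisk f g).choose v))
    rw [(exists_isometry_orbitDisk f _).choose_spec, (exists_isometry_orbitDisk f _).choose_spec,
      (exists_isometry_orbitDisk f _).choose_spec, smulComp_mul]
  α x := evalFunctional G f x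
  continuous_α := WeakDual.continuous_of_continuous_eval fun v =>
    ((orbitDisk G f).incl v).continuous
  bounded_α := ⟨‖(orbitDisk G f).incl‖, fun x => ContinuousLinearMap.opNorm_le_bound _
    (norm_nonneg (orbitDisk G f).incl) fun v => (((orbitDisk G f).incl v).norm_coe_le_norm x).trans
      ((orbitDisk G f).incl.le_opNorm v)⟩
  equivariant_α g x v := by
    rw [evalFunctional_apply, evalFunctional_apply, (exists_isometry_orbitDisk f g).choose_spec,
      smulComp_apply]

theorem incl_orbitRepresentation (f : C(X, ℝ)) (g : G) (v : (orbitDisk G f).Space) :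
    (orbitDisk G f).incl ((orbitRepresentation G f).h g v) =
      smulComp g ((orbitDisk G f).incl v) :=
  (exists_isometry_orbitDisk f g).choose_spec v

theorem dualAct_evalFunctional (f : C(X, ℝ)) (g : G) (x : X) :
    (orbitRepresentation G f).dualAct g (evalFunctional G f x) = evalFunctional G f (g • x) := by
  ext v
  rw [dualAct_apply, evalFunctional_apply, incl_orbitRepresentation, smulComp_apply,
    evalFunctional_apply]

/-- Elements of the hull of an orbit are limits of absolutely convex combinations. -/
theorem exists_finsupp_norm_sub_le {f w : C(X, ℝ)} (hw : w ∈ orbitHull G f) {η : ℝ} (hη : 0 < η) :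
    ∃ c : G →₀ ℝ, ∑ g ∈ c.support, |c g| ≤ 1 ∧
      ‖w - ∑ g ∈ c.support, c g • smulComp g f‖ ≤ η := by
  classical
  let S : Set C(X, ℝ) := {u | ∃ c : G →₀ ℝ, ∑ g ∈ c.support, |c g| ≤ 1 ∧
    ∑ g ∈ c.support, c g • smulComp g f = u}
  have hsum (c : G →₀ ℝ) (s : Finset G) (hs : c.support ⊆ s) :
      ∑ g ∈ c.support, |c g| = ∑ g ∈ s, |c g| ∧
        ∑ g ∈ c.support, c g • smulComp g f = ∑ g ∈ s, c g • smulComp g f := by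
    constructor <;>
    · refine Finset.sum_subset hs fun g _ hg => ?_
      rw [Finsupp.notMem_support_iff.mp hg]
      simp
  have hS : Convex ℝ S := by
    rintro _ ⟨c, hc, rfl⟩ _ ⟨c', hc', rfl⟩ a b ha hb hab
    let s := c.support ∪ c'.support ∪ (a • c + b • c').support
    have h1 := hsum c s (Finset.subset_union_left.trans Finset.subset_union_left)
    have h2 := hsum c' s (Finset.subset_union_right.trans Finset.subset_union_left)
    have h3 := hsum (a • c + b • c') s Finset.subset_union_right
    rw [h1.1] at hc
    rw [h2.1] at hc'
    refine ⟨a • c + b • c', ?_, ?_⟩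
    · rw [h3.1]
      calc ∑ g ∈ s, |(a • c + b • c') g| ≤ ∑ g ∈ s, (a * |c g| + b * |c' g|) := by
            refine Finset.sum_le_sum fun g _ => (abs_add_le _ _).trans_eq ?_
            rw [Finsupp.smul_apply, Finsupp.smul_apply, smul_eq_mul, smul_eq_mul, abs_mul, abs_mul,
              abs_of_nonneg ha, abs_of_nonneg hb]
        _ = a * ∑ g ∈ s, |c g| + b * ∑ g ∈ s, |c' g| := by
            rw [Finset.sum_add_distrib, Finset.mul_sum, Finset.mul_sum]
        _ ≤ 1 := by nlinarith
    · rw [h3.2, h1.2, h2.2, Finset.smul_sum, Finset.smul_sum, ← Finset.sum_add_distrib]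
      refine Finset.sum_congr rfl fun g _ => ?_
      rw [Finsupp.add_apply, Finsupp.smul_apply, Finsupp.smul_apply, add_smul, smul_assoc,
        smul_assoc]
  have hneg : ∀ u ∈ S, -u ∈ S := by
    rintro _ ⟨c, hc, rfl⟩
    refine ⟨-c, ?_, ?_⟩
    · simpa [Finsupp.support_neg] using hc
    · simp [Finsupp.support_neg]
  have hmem : ∀ g : G, smulComp g f ∈ S := fun g => by
    refine ⟨Finsupp.single g 1, ?_, ?_⟩
    · rw [Finsupp.support_single _ one_ne_zero]; simp
    · rw [Finsupp.support_single _ one_ne_zero]; simp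
  have hw' : w ∈ closure S := orbitHull_subset hS.closure isClosed_closure
    (fun u hu => map_mem_closure continuous_neg hu hneg) (fun g => subset_closure (hmem g)) hw
  obtain ⟨_, ⟨c, hc, rfl⟩, hd⟩ := Metric.mem_closure_iff.mp hw' η hη
  exact ⟨c, hc, by rw [← dist_eq_norm]; exact hd.le⟩

/-- The elements of the hull of an orbit oscillate no more than the function. -/
theorem abs_sub_le_of_mem_orbitHull {f w : C(X, ℝ)} (hw : w ∈ orbitHull G f) {η : ℝ}
    (hf : ∀ x y, |f x - f y| ≤ η) (x y : X) : |w x - w y| ≤ η := by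
  have : w ∈ ({u : C(X, ℝ) | |u x - u y| ≤ η} : Set C(X, ℝ)) := by
    refine orbitHull_subset (G := G) (f := f) ?_ ?_ ?_ (fun g => hf _ _) hw
    · intro u hu v hv a b ha hb hab
      change |a * u x + b * v x - (a * u y + b * v y)| ≤ η
      have hu := abs_le.mp (show |u x - u y| ≤ η from hu)
      have hv := abs_le.mp (show |v x - v y| ≤ η from hv)
      rw [abs_le]
      constructor <;> nlinarith
    · exact isClosed_le (((continuous_eval_const x).sub
        (continuous_eval_const y)).abs) continuous_const
    · intro u hu
      change |-u x - -u y| ≤ η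
      rw [neg_sub_neg, abs_sub_comm]
      exact hu
  exact this

/-- If `f` oscillates little compared to its values, the evaluations are almost invariant. -/
theorem exists_almost_invariant {f : C(X, ℝ)} {δ η : ℝ} (hf : ∀ x y, |f x - f y| ≤ η) (n : ℕ)
    (hη : 2 * 2 ^ (n + 1) * η + 4 * ((2 : ℝ) ^ (n + 1))⁻¹ ≤ δ) (x : X) (hx : 1 ≤ f x) :
    ∃ ξ : StrongDual ℝ (orbitDisk G f).Space, ‖ξ‖ = 1 ∧
      ∀ g : G, ‖(orbitRepresentation G f).dualAct g ξ - ξ‖ ≤ δ := by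
  have hη0 : 0 ≤ η := (abs_nonneg _).trans (hf x x)
  have hδ : 0 ≤ δ := le_trans (by positivity) hη
  -- The function `f` itself is a vector of norm at most `1`, and its value at `x` is at least `1`.
  -- Normalizing therefore does not increase differences of evaluations.
  have hnorm : 1 ≤ ‖evalFunctional G f x‖ := by
    obtain ⟨v, hv, hv1⟩ := (orbitDisk G f).exists_incl_eq (self_mem_orbitHull f)
    have h1 := (evalFunctional G f x).le_opNorm v
    rw [evalFunctional_apply, hv, Real.norm_eq_abs] at h1
    nlinarith [le_abs_self (f x), norm_nonneg (evalFunctional G f x)]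
  have hpos : 0 < ‖evalFunctional G f x‖ := zero_lt_one.trans_le hnorm
  refine ⟨‖evalFunctional G f x‖⁻¹ • evalFunctional G f x, ?_, fun g => ?_⟩
  · rw [norm_smul, norm_inv, norm_norm, inv_mul_cancel₀ hpos.ne']
  have hsmul : (orbitRepresentation G f).dualAct g
      (‖evalFunctional G f x‖⁻¹ • evalFunctional G f x) =
      ‖evalFunctional G f x‖⁻¹ • evalFunctional G f (g • x) := by
    rw [← dualAct_evalFunctional]
    rfl
  have hsub : ‖evalFunctional G f x‖⁻¹ • evalFunctional G f (g • x) -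
      ‖evalFunctional G f x‖⁻¹ • evalFunctional G f x =
      ‖evalFunctional G f x‖⁻¹ • (evalFunctional G f (g • x) - evalFunctional G f x) :=
    (smul_sub _ _ _).symm
  rw [hsmul, hsub, norm_smul, norm_inv, norm_norm, inv_mul_le_iff₀ hpos]
  refine le_trans ?_ (le_mul_of_one_le_left hδ hnorm)
  refine ContinuousLinearMap.opNorm_le_of_unit_norm hδ fun v hv => ?_
  -- The approximation error counts once at each of the two points, which gives the `4`; the
  -- oscillation of `w` is scaled by `2 * 2 ^ (n + 1)`.
  obtain ⟨w, hw, hvw⟩ := (orbitDisk G f).exists_norm_incl_sub_le v hv.le n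
  refine le_trans ?_ hη
  set u := (orbitDisk G f).incl v with hu
  have h1 (y : X) : |u y - 2 * 2 ^ (n + 1) * w y| ≤ 2 * ((2 : ℝ) ^ (n + 1))⁻¹ :=
    ((u - (2 * 2 ^ (n + 1) : ℝ) • w).norm_coe_le_norm y).trans hvw
  have h2 : |2 * 2 ^ (n + 1) * w (g • x) - 2 * 2 ^ (n + 1) * w x| ≤ 2 * 2 ^ (n + 1) * η := by
    rw [← mul_sub, abs_mul, abs_of_pos (by positivity : (0 : ℝ) < 2 * 2 ^ (n + 1))]
    exact mul_le_mul_of_nonneg_left (abs_sub_le_of_mem_orbitHull hw hf _ _) (by positivity)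
  have h3 := abs_le.mp (h1 (g • x))
  have h4 := abs_le.mp (h1 x)
  have h5 := abs_le.mp h2
  change |u (g • x) - u x| ≤ _
  rw [abs_le]
  constructor <;> linarith

end OrbitDisk

end

noncomputable section

open Filter Topology MeasureTheory

/-! ### The main theorem -/

namespace BoundarySubshift

variable (P : TopologicalSpace.Clopens Boundary)

/-- The function on the subshift with the value `1 + ε` on `P` and `1` off `P`. -/
def twoValued (ε : ℝ) : C(BoundarySubshift P, ℝ) where
  toFun x := if x.1 1 = true then 1 + ε else 1
  continuous_toFun := by
    have h : Continuous fun b : Bool => if b = true then 1 + ε else 1 :=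
      continuous_of_discreteTopology
    exact h.comp ((continuous_apply (1 : F2)).comp continuous_subtype_val)

theorem twoValued_apply (ε : ℝ) (x : BoundarySubshift P) :
    twoValued P ε x = if x.1 1 = true then 1 + ε else 1 := rfl

open Classical in
theorem smulComp_twoValued_factor (ε : ℝ) (g : F2) (ω : Boundary) :
    smulComp g (twoValued P ε) (factor P ω) = if g • ω ∈ P then 1 + ε else 1 := by
  rw [smulComp_apply, smul_factor, twoValued_apply]
  refine if_congr ?_ rfl rfl
  change nameMap P (g • ω) 1 = true ↔ _
  simp [nameMap]

theorem abs_twoValued_sub_le {ε : ℝ} (hε : 0 ≤ ε) (x y : BoundarySubshift P) :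
    |twoValued P ε x - twoValued P ε y| ≤ ε := by
  rw [twoValued_apply, twoValued_apply, abs_le]
  split_ifs <;> constructor <;> linarith

theorem one_le_twoValued {ε : ℝ} (hε : 0 ≤ ε) (x : BoundarySubshift P) :
    1 ≤ twoValued P ε x := by
  rw [twoValued_apply]
  split_ifs <;> linarith

/-- Bounded sequences in the DFJP space have pointwise convergent subsequences. -/
theorem exists_subseq_pointwise (ε : ℝ) (v : ℕ → (orbitDisk F2 (twoValued P ε)).Space)
    (hv : ∀ k, ‖v k‖ ≤ 1) : ∃ ψ : ℕ → ℕ, StrictMono ψ ∧ ∀ x,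
      CauchySeq fun k => (orbitDisk F2 (twoValued P ε)).incl (v (ψ k)) x := by
  classical
  have happrox (k n : ℕ) : ∃ c : F2 →₀ ℝ, ∑ g ∈ c.support, |c g| ≤ 1 ∧
      ‖(orbitDisk F2 (twoValued P ε)).incl (v k) - (2 * 2 ^ (n + 1) : ℝ) •
        ∑ g ∈ c.support, c g • smulComp g (twoValued P ε)‖ ≤ 3 * ((2 : ℝ) ^ (n + 1))⁻¹ := by
    obtain ⟨w, hw, hvw⟩ := (orbitDisk F2 (twoValued P ε)).exists_norm_incl_sub_le (v k) (hv k) n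
    obtain ⟨c, hc, hwc⟩ := exists_finsupp_norm_sub_le hw
      (η := (2 * 2 ^ (n + 1) : ℝ)⁻¹ * ((2 : ℝ) ^ (n + 1))⁻¹) (by positivity)
    refine ⟨c, hc, ?_⟩
    set s := ∑ g ∈ c.support, c g • smulComp g (twoValued P ε) with hs
    have h1 : ‖(2 * 2 ^ (n + 1) : ℝ) • (w - s)‖ ≤ ((2 : ℝ) ^ (n + 1))⁻¹ := by
      rw [norm_smul, Real.norm_of_nonneg (by positivity)]
      rwa [← le_inv_mul_iff₀ (by positivity)]
    have h2 := norm_add_le ((orbitDisk F2 (twoValued P ε)).incl (v k) - (2 * 2 ^ (n + 1) : ℝ) • w)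
      ((2 * 2 ^ (n + 1) : ℝ) • (w - s))
    rw [smul_sub, sub_add_sub_cancel] at h2
    rw [smul_sub] at h1
    linarith
  choose c hc hvc using happrox
  -- The precision `n` plays the part of the countable index, so one subsequence serves all
  -- precisions at once.
  obtain ⟨ψ, hψ, h⟩ := Boundary.exists_subseq_cauchySeq_orbit P (1 + ε) 1 c hc
  refine ⟨ψ, hψ, fun x => ?_⟩
  obtain ⟨ω, rfl⟩ := factor_surjective P x
  refine cauchySeq_of_forall_approx fun η hη => ?_
  obtain ⟨n, hn⟩ := exists_pow_lt_of_lt_one (div_pos hη (by norm_num : (0 : ℝ) < 3))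
    (by norm_num : (1 / 2 : ℝ) < 1)
  refine ⟨fun k => 2 * 2 ^ (n + 1) * ∑ g ∈ (c (ψ k) n).support,
    c (ψ k) n g * (if g • ω ∈ P then 1 + ε else 1), ?_, Eventually.of_forall fun k => ?_⟩
  · obtain ⟨L, hL⟩ := cauchySeq_tendsto_of_complete (h n ω)
    exact (hL.const_mul _).cauchySeq
  · have h1 := ((((orbitDisk F2 (twoValued P ε)).incl (v (ψ k)) - (2 * 2 ^ (n + 1) : ℝ) •
      ∑ g ∈ (c (ψ k) n).support, c (ψ k) n g • smulComp g (twoValued P ε))).norm_coe_le_norm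
        (factor P ω)).trans (hvc (ψ k) n)
    have h2 : 3 * ((2 : ℝ) ^ (n + 1))⁻¹ ≤ η := by
      have e : ((2 : ℝ) ^ (n + 1))⁻¹ ≤ (1 / 2) ^ n := by
        rw [one_div, inv_pow]
        exact inv_anti₀ (by positivity) (pow_le_pow_right₀ one_le_two (Nat.le_succ n))
      linarith
    have h3 : (∑ g ∈ (c (ψ k) n).support, c (ψ k) n g • smulComp g (twoValued P ε)) (factor P ω) =
        ∑ g ∈ (c (ψ k) n).support, c (ψ k) n g * (if g • ω ∈ P then 1 + ε else 1) := by
      rw [ContinuousMap.sum_apply]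
      refine Finset.sum_congr rfl fun g _ => ?_
      rw [ContinuousMap.smul_apply, smul_eq_mul, smulComp_twoValued_factor]
    rw [Real.norm_eq_abs, ContinuousMap.sub_apply, ContinuousMap.smul_apply, h3, smul_eq_mul] at h1
    exact h1.trans h2

/-- Pointwise Cauchy subsequences are weakly Cauchy for functionals coming from `C(X)`, and these
approximate every functional on the DFJP space in norm. -/
theorem isRosenthal_space (ε : ℝ) : IsRosenthal (orbitDisk F2 (twoValued P ε)).Space := by
  refine isRosenthal_of_weaklyCauchy fun v hv => ?_
  obtain ⟨ψ, hψ, h⟩ := exists_subseq_pointwise P ε v hv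
  refine ⟨ψ, hψ, fun φ => cauchySeq_of_forall_approx fun η hη => ?_⟩
  obtain ⟨μ, hμ⟩ := (orbitDisk F2 (twoValued P ε)).exists_dual_abs_sub_le φ hη
  refine ⟨fun k => μ ((orbitDisk F2 (twoValued P ε)).incl (v (ψ k))), ?_,
    Eventually.of_forall fun k => ?_⟩
  · refine cauchySeq_dual_of_pointwise μ _ ‖(orbitDisk F2 (twoValued P ε)).incl‖ (fun k => ?_) h
    exact ((orbitDisk F2 (twoValued P ε)).incl.le_opNorm _).trans
      (mul_le_of_le_one_right (norm_nonneg _) (hv _))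
  · exact (hμ _).trans (mul_le_of_le_one_right hη.le (hv _))

variable {P}

/-- An invariant functional is approximately a multiple of each evaluation. -/
theorem exists_abs_sub_mul_le (h0 : P ≠ ⊥) (h1 : P ≠ ⊤) {f : C(BoundarySubshift P, ℝ)}
    {φ : StrongDual ℝ (orbitDisk F2 f).Space}
    (hφ : ∀ g : F2, (orbitRepresentation F2 f).dualAct g φ = φ) {η : ℝ} (hη : 0 < η) :
    ∃ c : ℝ, ∀ v x, |φ v - c * (orbitDisk F2 f).incl v x| ≤ η * ‖v‖ := by
  have hinv (g : F2) (v : (orbitDisk F2 f).Space) :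
      φ ((orbitRepresentation F2 f).h g v) = φ v := by
    rw [← dualAct_apply, hφ]
  obtain ⟨μ, hμ⟩ := (orbitDisk F2 f).exists_dual_abs_sub_le φ hη
  obtain ⟨m, hm, hμm⟩ := exists_measure_abs_le_integral μ
  obtain ⟨l, hl, hlim⟩ := exists_contracting h0 h1 m
  set z := pole P (0, true) with hz
  have key (v : (orbitDisk F2 f).Space) :
      |φ v - μ 1 * (orbitDisk F2 f).incl v z| ≤ η * ‖v‖ := by
    set u := (orbitDisk F2 f).incl v with hu
    -- Along the contracting net, `u ∘ g` tends to the constant `u z` in `L¹` of the dominating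
    -- measure. Invariance of `φ` lets `v` be replaced by its translates.
    have ht : Tendsto (fun g : F2 => μ (smulComp g u)) l (𝓝 (μ 1 * u z)) := by
      rw [tendsto_iff_norm_sub_tendsto_zero]
      refine squeeze_zero (fun _ => norm_nonneg _) (fun g => ?_) (hlim u)
      have e : μ (smulComp g u) - μ 1 * u z = μ (smulComp g u - u z • 1) := by
        rw [map_sub, map_smul, smul_eq_mul, mul_comm]
      rw [e]
      refine (hμm _).trans_eq (integral_congr_ae (ae_of_all _ fun x => ?_))
      simp [smulComp_apply]
    refine le_of_tendsto ((tendsto_const_nhds.sub ht).abs) (Eventually.of_forall fun g => ?_)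
    have := hμ ((orbitRepresentation F2 f).h g v)
    rwa [hinv, incl_orbitRepresentation, LinearIsometryEquiv.norm_map] at this
  refine ⟨μ 1, fun v => ?_⟩
  have hclosed : IsClosed {x | |φ v - μ 1 * (orbitDisk F2 f).incl v x| ≤ η * ‖v‖} :=
    isClosed_le (by fun_prop) continuous_const
  -- Translating `v` moves the estimate from `z` to its whole orbit, and density of the orbit gives
  -- all points with the same constant.
  have hsub : MulAction.orbit F2 z ⊆ {x | |φ v - μ 1 * (orbitDisk F2 f).incl v x| ≤ η * ‖v‖} := by
    rintro _ ⟨g, rfl⟩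
    have := key ((orbitRepresentation F2 f).h g v)
    rwa [hinv, incl_orbitRepresentation, LinearIsometryEquiv.norm_map, smulComp_apply] at this
  intro x
  exact hclosed.closure_subset_iff.mpr hsub (MulAction.dense_orbit F2 z x)

/-- At points where the generating function equals `1 + ε` and `1`, the same constant `c` must
almost reproduce one value of `φ`. Hence `|c| * ε ≤ 2 * η`, and `φ v` vanishes as `η` tends to `0`.
-/
theorem eq_zero_of_invariant (h0 : P ≠ ⊥) (h1 : P ≠ ⊤) {ε : ℝ} (hε : 0 < ε)
    {φ : StrongDual ℝ (orbitDisk F2 (twoValued P ε)).Space}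
    (hφ : ∀ g : F2, (orbitRepresentation F2 (twoValued P ε)).dualAct g φ = φ) : φ = 0 := by
  obtain ⟨x, y, hx, hy⟩ := exists_apply_one_ne h0 h1
  obtain ⟨w, hw, hw1⟩ := (orbitDisk F2 (twoValued P ε)).exists_incl_eq
    (self_mem_orbitHull (twoValued P ε))
  ext v
  rw [zero_apply]
  have hbound : ∀ η > 0, |φ v| ≤ η * (‖v‖ + 2 / ε * |(orbitDisk F2 (twoValued P ε)).incl v x|) := by
    intro η hη
    obtain ⟨c, hc⟩ := exists_abs_sub_mul_le h0 h1 hφ hη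
    have hwx := abs_le.mp (hc w x)
    have hwy := abs_le.mp (hc w y)
    rw [hw, twoValued_apply, if_pos hx] at hwx
    rw [hw, twoValued_apply, if_neg (by rw [hy]; exact Bool.false_ne_true)] at hwy
    have hηw : η * ‖w‖ ≤ η := mul_le_of_le_one_right hη.le hw1
    have hcε : |c| ≤ 2 / ε * η := by
      rw [div_mul_eq_mul_div, le_div_iff₀ hε]
      refine le_of_eq_of_le (b := |c * ε|) (by rw [abs_mul, abs_of_pos hε]) (abs_le.mpr ?_)
      constructor <;> linarith
    have hv := abs_le.mp (hc v x)
    have hcv : |c * (orbitDisk F2 (twoValued P ε)).incl v x| ≤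
        2 / ε * η * |(orbitDisk F2 (twoValued P ε)).incl v x| := by
      rw [abs_mul]
      exact mul_le_mul_of_nonneg_right hcε (abs_nonneg _)
    have hcv' := abs_le.mp hcv
    rw [abs_le]
    constructor <;> nlinarith
  have hlim : Tendsto (fun η : ℝ => η * (‖v‖ + 2 / ε * |(orbitDisk F2 (twoValued P ε)).incl v x|))
      (𝓝[>] 0) (𝓝 0) := by
    have : Tendsto (fun η : ℝ => η * (‖v‖ + 2 / ε * |(orbitDisk F2 (twoValued P ε)).incl v x|))
      (𝓝 0)
      (𝓝 (0 * (‖v‖ + 2 / ε * |(orbitDisk F2 (twoValued P ε)).incl v x|))) := tendsto_id.mul_const _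
    rw [zero_mul] at this
    exact this.mono_left nhdsWithin_le_nhds
  exact abs_nonpos_iff.mp (ge_of_tendsto hlim (eventually_mem_nhdsWithin.mono hbound))

theorem exists_representation (h0 : P ≠ ⊥) (h1 : P ≠ ⊤) {δ : ℝ} (hδ : 0 < δ) :
    ∃ (V : Type) (_ : NormedAddCommGroup V) (_ : NormedSpace ℝ V) (_ : CompleteSpace V)
      (_ : TopologicalSpace.SeparableSpace V)
      (R : BanachRepresentation F2 (BoundarySubshift P) V)
      (f : C(BoundarySubshift P, ℝ)) (j : V →L[ℝ] C(BoundarySubshift P, ℝ)),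
      IsRosenthal V ∧
      IsDFJPInclusion (orbitHull F2 f) j ∧
      (∀ (g : F2) (v : V) (x : BoundarySubshift P), j (R.h g v) x = j v (g • x)) ∧
      (∀ (x : BoundarySubshift P) (v : V), R.α x v = j v x) ∧
      (∀ φ : StrongDual ℝ V, (∀ g : F2, R.dualAct g φ = φ) ↔ φ = 0) ∧
      (∃ ξ : StrongDual ℝ V, ‖ξ‖ = 1 ∧ ∀ g : F2, ‖R.dualAct g ξ - ξ‖ ≤ δ) := by
  -- The exponent `n` makes the approximation term less than `δ / 2`; afterwards `ε` is chosen to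
  -- make the oscillation term equal to `δ / 2`.
  obtain ⟨n, hn⟩ := exists_pow_lt_of_lt_one (div_pos hδ (by norm_num : (0 : ℝ) < 8))
    (by norm_num : (1 / 2 : ℝ) < 1)
  have hpow : (0 : ℝ) < 2 * 2 ^ (n + 1) := by positivity
  set ε : ℝ := δ / 2 / (2 * 2 ^ (n + 1)) with hεdef
  have hε : 0 < ε := by positivity
  have hsmall : 2 * 2 ^ (n + 1) * ε + 4 * ((2 : ℝ) ^ (n + 1))⁻¹ ≤ δ := by
    have e : ((2 : ℝ) ^ (n + 1))⁻¹ ≤ (1 / 2) ^ n := by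
      rw [one_div, inv_pow]
      exact inv_anti₀ (by positivity) (pow_le_pow_right₀ one_le_two (Nat.le_succ n))
    rw [hεdef, mul_div_cancel₀ _ hpow.ne']
    linarith
  set f := twoValued P ε with hf
  refine ⟨(orbitDisk F2 f).Space, inferInstance, inferInstance, inferInstance, inferInstance,
    orbitRepresentation F2 f, f, (orbitDisk F2 f).incl, isRosenthal_space P ε,
    (orbitDisk F2 f).isDFJPInclusion, fun g v x => ?_, fun x v => rfl, fun φ => ⟨fun hφ => ?_, ?_⟩,
    ?_⟩
  · rw [incl_orbitRepresentation, smulComp_apply]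
  · exact eq_zero_of_invariant h0 h1 hε hφ
  · rintro rfl g
    rfl
  · exact exists_almost_invariant (abs_twoValued_sub_le P hε.le) n hsmall (pole P (0, true))
      (one_le_twoValued P hε.le _)

end BoundarySubshift

/-! ### The counterexample to the assertion on almost invariant functionals. -/

/-- The words that begin with the first generator. -/
def firstCylinder : TopologicalSpace.Clopens Boundary where
  carrier := {ω | ω.1 0 = (0, true)}
  isClopen' := (isClopen_discrete {((0, true) : Letter)}).preimage
    ((continuous_apply 0).comp continuous_subtype_val)

theorem firstCylinder_ne_bot : firstCylinder ≠ ⊥ := fun h => by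
  have : Boundary.power (0, true) ∈ firstCylinder := rfl
  rw [h] at this
  exact this

theorem firstCylinder_ne_top : firstCylinder ≠ ⊤ := fun h => by
  have : Boundary.power (1, true) ∈ firstCylinder := by
    rw [h]
    trivial
  have h' : ((1, true) : Letter) = (0, true) := this
  simp at h'

/-- For the representation built with `δ / 10`, the only candidate `β` is `0`, at distance `1 > δ`
from `ξ`. -/
theorem not_almostInvariantAssertion {δ : ℝ} (hδ : 0 < δ) (hδ1 : δ < 1) :
    ¬ AlmostInvariantAssertion δ := by
  intro h
  obtain ⟨V, _, _, _, _, R, -, -, -, -, -, -, hfix, ξ, hξ, hξδ⟩ :=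
    BoundarySubshift.exists_representation firstCylinder_ne_bot firstCylinder_ne_top
      (δ := δ / 10) (by positivity)
  -- Inversion turns the co-homomorphism into a homomorphism, and the inverse in the assertion's
  -- dual action undoes it.
  let ρ : F2 →* (V ≃ₗᵢ[ℝ] V) := MonoidHom.mk' (fun g => R.h g⁻¹) fun g g' => by
    rw [mul_inv_rev, R.h_mul]
  have hρ (g : F2) : ρ g⁻¹ = R.h g := by
    change R.h g⁻¹⁻¹ = R.h g
    rw [inv_inv]
  obtain ⟨β, hβ, hξβ⟩ := h F2 V ρ ξ hξ fun g => by
    rw [hρ]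
    exact hξδ g
  have : β = 0 := (hfix β).mp fun g => by
    have := hβ g
    rwa [hρ] at this
  rw [this, sub_zero, hξ] at hξβ
  linarith

end

theorem theorem4p6 :
    (∀ P : TopologicalSpace.Clopens Boundary, P ≠ ⊥ → P ≠ ⊤ →
      MulAction.IsMinimal F2 (BoundarySubshift P) ∧
      IsStronglyProximal F2 (BoundarySubshift P) ∧
      ∀ δ : ℝ, 0 < δ → δ < 1 →
        ∃ (V : Type) (_ : NormedAddCommGroup V) (_ : NormedSpace ℝ V) (_ : CompleteSpace V)
          (_ : TopologicalSpace.SeparableSpace V)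
          (R : BanachRepresentation F2 (BoundarySubshift P) V)
          (f : C(BoundarySubshift P, ℝ)) (j : V →L[ℝ] C(BoundarySubshift P, ℝ)),
          IsRosenthal V ∧
          IsDFJPInclusion (orbitHull F2 f) j ∧
          (∀ (g : F2) (v : V) (x : BoundarySubshift P), j (R.h g v) x = j v (g • x)) ∧
          (∀ (x : BoundarySubshift P) (v : V), R.α x v = j v x) ∧
          (∀ φ : StrongDual ℝ V, (∀ g : F2, R.dualAct g φ = φ) ↔ φ = 0) ∧
          (∃ ξ : StrongDual ℝ V, ‖ξ‖ = 1 ∧ ∀ g : F2, ‖R.dualAct g ξ - ξ‖ ≤ δ)) ∧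
    (∀ δ : ℝ, 0 < δ → δ < 1 → ¬ AlmostInvariantAssertion δ) :=
  ⟨fun _ h0 h1 => ⟨inferInstance, BoundarySubshift.isStronglyProximal h0 h1,
    fun _ hδ _ => BoundarySubshift.exists_representation h0 h1 hδ⟩,
    fun _ hδ hδ1 => not_almostInvariantAssertion hδ hδ1⟩
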